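/- For $n\ge 3$ let $\mathcal G_n$ be the cylindrical square grid with vertices $(x,y)$, $x\in\mathbb Z/n\mathbb Z$, $y\in\{0,\dots,n-1\}$, where $(x,y)$ is joined to $(x+1,y)$ and (if $y<n-1$) to $(x,y+1)$; wire it by adding one extra vertex $r$ joined to all vertices of the bottom row $y=0$ and of the top row $y=n-1$. A unitary connection $\Phi$ assigns to each oriented edge $vw$ a unit complex number $\varphi_{vw}$ with $\varphi_{wv}=\varphi_{vw}^{-1}$; its monodromy around an oriented cycle is the product of the $\varphi_{vw}$ along the cycle, and $I$ is the connection with all $\varphi_{vw}=1$. An essential CRSF is a spanning subgraph of the wired graph in which the component of $r$ is a tree and every other component contains exactly one cycle. Its weight is $\prod_{\gamma}(2-2\cos\theta_\gamma)$, the product being over its cycles $\gamma$, where $e^{i\theta_\gamma}$ is the monodromy of $\Phi$ around $\gamma$ (in either orientation). Let $Z_\Phi$ be the sum of the weights of all essential CRSFs, and $\mu_\Phi$ the probability measure giving each essential CRSF a probability proportional to its weight. For a real number $c$, let $\Phi$ be a unitary connection whose monodromy around every square face of the cylinder (all faces being oriented in the same way, namely up, right, down, left) is $e^{ic/n^2}$,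 and whose monodromy around the bottom row $y=0$ is $1$. (Up to gauge equivalence on the cylinder, this is the connection with parallel transport $e^{icy/n^2}$ from $(x,y)$ to $(x+1,y)$ and the identity on vertical edges.) Then $$\frac{Z_\Phi}{Z_I}=1+O(c^2),$$ and with $\mu_\Phi$-probability $1-O(c^2)$ the essential CRSF has no loops (cycles). Precisely: for every $C>0$ there is a constant $K>0$ such that, for all $n\ge 3$, all real $c$ with $|c|\le C$ and all such $\Phi$, one has $Z_I>0$, $Z_\Phi>0$, $$\left|\frac{Z_\Phi}{Z_I}-1\right|\le Kc^2\qquad\text{and}\qquad \mu_\Phi(\text{no cycles})\ge 1-Kc^2 .$$ -/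

import Mathlib

/-- The `n × n` cylindrical square grid (circumference `n`, coordinate `x : ZMod n`; height `n`,
coordinate `y : Fin n`), wired: the extra vertex `none` is joined to every vertex of the bottom row
`y = 0` and of the top row `y = n - 1`. -/
def wiredCylinder (n : ℕ) : SimpleGraph (Option (ZMod n × Fin n)) :=
  SimpleGraph.fromRel fun v w =>
    match v, w with
    | some (x, y), some (x', y') => (x' = x + 1 ∧ y' = y) ∨ (x' = x ∧ y'.val = y.val + 1)
    | none, some (_, y) => y.val = 0 ∨ y.val + 1 = n
    | _, none => False

namespace CRSF

variable {W : Type*}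

/-- A unitary connection on the trivialised complex line bundle over the graph `G`: a unit complex
number `Φ v w` for each oriented edge `vw`, with `Φ w v = (Φ v w)⁻¹`. The value on pairs that are
not edges is never used. -/
structure Connection (G : SimpleGraph W) where
  transport : W → W → Circle
  transport_symm : ∀ v w, G.Adj v w → transport w v = (transport v w)⁻¹

/-- The identity connection. -/
noncomputable def Connection.trivial (G : SimpleGraph W) : Connection G where
  transport _ _ := 1
  transport_symm _ _ _ := inv_one.symm

variable [Fintype W] [DecidableEq W]

/-- An oriented simple cycle of `Γ`, encoded as the cyclic permutation of the vertex set which sends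
each vertex of the cycle to its successor and fixes every other vertex. -/
def IsOrientedCycle (Γ : SimpleGraph W) (σ : Equiv.Perm W) : Prop :=
  σ.IsCycle ∧ 3 ≤ σ.support.card ∧ ∀ v ∈ σ.support, Γ.Adj v (σ v)

open Classical in
/-- The (unoriented) cycles of `Γ` whose vertices all lie in `S`. An unoriented cycle is the
unordered pair `{σ, σ⁻¹}` of its two orientations. -/
noncomputable def cyclesIn (Γ : SimpleGraph W) (S : Set W) : Finset (Sym2 (Equiv.Perm W)) :=
  (Finset.univ.filter fun σ : Equiv.Perm W =>
    IsOrientedCycle Γ σ ∧ ∀ v ∈ σ.support, v ∈ S).image fun σ => s(σ, σ⁻¹)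

/-- All cycles of `Γ`. -/
noncomputable def cycles (Γ : SimpleGraph W) : Finset (Sym2 (Equiv.Perm W)) :=
  cyclesIn Γ Set.univ

/-- Monodromy `e^{iθ}` of a connection around an oriented cycle. -/
noncomputable def monodromy {G : SimpleGraph W} (Φ : Connection G) (σ : Equiv.Perm W) : Circle :=
  ∏ v ∈ σ.support, Φ.transport v (σ v)

/-- The weight of an unoriented cycle `{σ, σ⁻¹}`, namely `2 - e^{iθ} - e^{-iθ} = 2 - 2 cos θ`, where
`e^{iθ}` and `e^{-iθ}` are the monodromies of its two orientations (see `cycleWeight_eq`). -/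
noncomputable def cycleWeight {G : SimpleGraph W} (Φ : Connection G) :
    Sym2 (Equiv.Perm W) → ℝ :=
  Sym2.lift ⟨fun σ τ => 2 - ((monodromy Φ σ : ℂ).re + (monodromy Φ τ : ℂ).re),
    fun _ _ => congrArg (2 - ·) (add_comm _ _)⟩

theorem monodromy_inv {G : SimpleGraph W} (Φ : Connection G) {σ : Equiv.Perm W}
    (hσ : IsOrientedCycle G σ) : monodromy Φ σ⁻¹ = (monodromy Φ σ)⁻¹ := by
  unfold monodromy
  rw [Equiv.Perm.support_inv, ← Finset.prod_inv_distrib]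
  symm
  refine Finset.prod_bij (fun v _ => σ v) (fun v hv => Equiv.Perm.apply_mem_support.mpr hv)
    (fun v _ w _ h => σ.injective h) (fun w hw => ⟨σ⁻¹ w, ?_, σ.apply_symm_apply w⟩) ?_
  · rw [← Equiv.Perm.support_inv] at hw ⊢
    exact Equiv.Perm.apply_mem_support.mpr hw
  · intro v hv
    have h : σ⁻¹ (σ v) = v := σ.symm_apply_apply v
    rw [h, Φ.transport_symm _ _ (hσ.2.2 v hv)]

theorem cycleWeight_eq {G : SimpleGraph W} (Φ : Connection G) {σ : Equiv.Perm W}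
    (hσ : IsOrientedCycle G σ) (θ : ℝ) (hθ : monodromy Φ σ = Circle.exp θ) :
    cycleWeight Φ s(σ, σ⁻¹) = 2 - 2 * Real.cos θ := by
  simp only [cycleWeight, Sym2.lift_mk]
  rw [monodromy_inv Φ hσ, hθ, ← Circle.exp_neg, Circle.coe_exp, Circle.coe_exp,
    Complex.exp_ofReal_mul_I_re, Complex.exp_ofReal_mul_I_re, Real.cos_neg]
  ring

/-- Essential cycle-rooted spanning forests of `G` with Dirichlet (wired) boundary vertex `r`:
spanning subgraphs of `G` in which the connected component of `r` is a tree and every other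
connected component contains exactly one cycle. -/
def IsEssential (G : SimpleGraph W) (r : W) (Γ : SimpleGraph W) : Prop :=
  Γ ≤ G ∧ ∀ C : Γ.ConnectedComponent,
    (r ∈ C.supp → (cyclesIn Γ C.supp).card = 0) ∧ (r ∉ C.supp → (cyclesIn Γ C.supp).card = 1)

/-- The weight of a forest: the product over its cycles of `2 - 2 cos θ`. -/
noncomputable def weight {G : SimpleGraph W} (Φ : Connection G) (Γ : SimpleGraph W) : ℝ :=
  ∏ z ∈ cycles Γ, cycleWeight Φ z

open Classical in
/-- The total weight of the essential CRSFs that belong to `A`. -/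
noncomputable def totalWeight {G : SimpleGraph W} (r : W) (Φ : Connection G)
    (A : Set (SimpleGraph W)) : ℝ :=
  ∑ Γ ∈ Finset.univ.filter (fun Γ : SimpleGraph W => IsEssential G r Γ ∧ Γ ∈ A), weight Φ Γ

/-- The partition function `Z_Φ`. -/
noncomputable def partitionFunction {G : SimpleGraph W} (r : W) (Φ : Connection G) : ℝ :=
  totalWeight r Φ Set.univ

/-- The probability of the event `A` under the measure `μ_Φ` on essential CRSFs that gives each of
them a probability proportional to its weight. -/
noncomputable def prob {G : SimpleGraph W} (r : W) (Φ : Connection G)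
    (A : Set (SimpleGraph W)) : ℝ :=
  totalWeight r Φ A / partitionFunction r Φ

end CRSF

/-- `Φ` has monodromy `e^{iφ}` around every square face of the cylinder. The face with lower left
corner `(x, y)` and upper height `y'` is traversed up, right, down, left. -/
def HasFaceMonodromy {n : ℕ} (Φ : CRSF.Connection (wiredCylinder n)) (φ : ℝ) : Prop :=
  ∀ (x : ZMod n) (y y' : Fin n), y'.val = y.val + 1 →
    Φ.transport (some (x, y)) (some (x, y')) *
      Φ.transport (some (x, y')) (some (x + 1, y')) *
      Φ.transport (some (x + 1, y')) (some (x + 1, y)) *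
      Φ.transport (some (x + 1, y)) (some (x, y)) = Circle.exp φ

/-- `Φ` has trivial monodromy around the bottom row `y = 0` of the cylinder. -/
def HasTrivialBottomMonodromy {n : ℕ} [NeZero n] (Φ : CRSF.Connection (wiredCylinder n)) : Prop :=
  ∏ x : ZMod n, Φ.transport (some (x, 0)) (some (x + 1, 0)) = 1

/-! By the matrix-tree theorem for line bundles, `partitionFunction_eq_det`, the partition function
is the determinant of the Laplacian of the connection with Dirichlet condition at the wired vertex.
The trivial connection kills every forest with a cycle, so Z_I counts the spanning trees, each of
which has weight 1 under every connection. Hence Z_I ≤ Z_Φ and the probability of having no cycle is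
exactly Z_I / Z_Φ; both claims reduce to an upper bound Z_Φ ≤ (1 + K c²) Z_I
(`ratio_and_prob_of_le`).

For the upper bound the two determinants are built up one vertex at a time, in order of increasing
row. Adding v to the domain S multiplies the determinant by the least Dirichlet energy among
functions equal to 1 at v and 0 outside S ∪ {v} (`det_lap_insert`, `lapOp_eq_energy`,
`energy_le_of_harmonic`). So it is enough to exhibit, for each of the n² vertices, a test function
whose Φ-energy exceeds the minimal energy of the trivial connection by a factor at most 1 +
O(c²/n²).

The test function is the real harmonic function h of the trivial problem multiplied by a gauge. The
gauge makes vertical transport trivial and horizontal transport e^{iθ}, with θ = (c/n²)(y - y₀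
cos(2π(x - x₀)/n)) for v = (x₀, y₀). The row monodromies cannot be gauged away, but the cosine,
having mean zero, moves them away from v, so that θ is at most of order c/n² times the distance to
v. The excess energy is at most the sum of θ² h h' over horizontal edges (`energy_gauge`,
`excess_energy_le`).

Because of the order of elimination, h vanishes on all rows above v. By the maximum principle it is
at most four times a Green's function whose pole lies next to a Dirichlet boundary
(`harmonic_bounds`), that is, a discrete Poisson kernel, which decays like 1/distance. In ℓ² form,
obtained by Parseval on each row, this says that distance² · h² sums to O(n) over a row
(`row_sum_le`). Over n rows the excess is O(n² · c²/n⁴) = O(c²/n²), while the minimal energy is at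
least 1 (`one_le_energy`). The product of the n² factors is at most exp(O(c²)). -/

set_option linter.unusedSectionVars false

/-! ### Expansion of the Laplacian determinant over outgoing maps -/

namespace CRSF

open Equiv

variable {W : Type*} [Fintype W] [DecidableEq W]

open Classical in
/-- The Laplacian of a connection with Dirichlet conditions off `S`: rows outside `S` are replaced
by the rows of the identity matrix. -/
noncomputable def lap {G : SimpleGraph W} (Φ : Connection G) (S : Finset W) : Matrix W W ℂ :=
  fun v w => if v ∈ S then
      (if v = w then (G.degree v : ℂ) else if G.Adj v w then -(Φ.transport v w : ℂ) else 0)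
    else if v = w then 1 else 0

open Classical in
/-- The functions sending `r` to itself and every other vertex to one of its neighbours. -/
noncomputable def outMaps (G : SimpleGraph W) (r : W) : Finset (W → W) :=
  Fintype.piFinset fun v => if v = r then {r} else G.neighborFinset v

theorem mem_outMaps {G : SimpleGraph W} {r : W} {f : W → W} :
    f ∈ outMaps G r ↔ f r = r ∧ ∀ v, v ≠ r → G.Adj v (f v) := by
  classical
  simp only [outMaps, Fintype.mem_piFinset]
  constructor
  · intro h
    refine ⟨by simpa using h r, fun v hv => ?_⟩
    have := h v
    rwa [if_neg hv, SimpleGraph.mem_neighborFinset] at this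
  · rintro ⟨h1, h2⟩ v
    by_cases hv : v = r
    · subst hv; simpa using h1
    · rw [if_neg hv, SimpleGraph.mem_neighborFinset]; exact h2 v hv

open Classical in
/-- The cyclic permutations that agree with `f` on their support. -/
noncomputable def followed (f : W → W) : Finset (Perm W) :=
  Finset.univ.filter fun σ => σ.IsCycle ∧ ∀ v ∈ σ.support, σ v = f v

theorem mem_followed {f : W → W} {σ : Perm W} :
    σ ∈ followed f ↔ σ.IsCycle ∧ ∀ v ∈ σ.support, σ v = f v := by
  simp [followed]

theorem followed_eq_of_mem {f : W → W} {σ τ : Perm W} (hσ : σ ∈ followed f) (hτ : τ ∈ followed f)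
    {v : W} (hv : v ∈ σ.support) (hv' : v ∈ τ.support) : σ = τ := by
  rw [mem_followed] at hσ hτ
  refine hσ.1.eq_on_support_inter_nonempty_congr hτ.1 (fun x hx => ?_) (x := v) ?_ hv
  · rw [Finset.mem_inter] at hx
    rw [hσ.2 x hx.1, hτ.2 x hx.2]
  · rw [hσ.2 v hv, hτ.2 v hv']

theorem followed_pairwise_disjoint (f : W → W) :
    (followed f : Set (Perm W)).Pairwise Perm.Disjoint := by
  intro σ hσ τ hτ hne
  rw [Perm.disjoint_iff_disjoint_support, Finset.disjoint_left]
  intro v hv hv'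
  exact hne (followed_eq_of_mem hσ hτ hv hv')

/-- Row `v` of the Laplacian restricted to the single edge from `v` to `w`. -/
noncomputable def edgeRow {G : SimpleGraph W} (Φ : Connection G) (r v w : W) : W → ℂ :=
  fun u => if v = r then (if v = u then 1 else 0)
    else (if v = u then 1 else 0) - (if w = u then (Φ.transport v w : ℂ) else 0)

open Classical in
theorem lap_row_eq_sum {G : SimpleGraph W} (Φ : Connection G) (r v : W) :
    lap Φ (Finset.univ.erase r) v =
      ∑ w ∈ (if v = r then {r} else G.neighborFinset v), edgeRow Φ r v w := by
  funext u
  rw [Finset.sum_apply]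
  by_cases hv : v = r
  · subst hv
    simp [lap, edgeRow]
  · simp only [lap, edgeRow, hv, if_false, Finset.mem_erase, ne_eq, not_false_eq_true,
      Finset.mem_univ, and_self, if_true, Finset.sum_sub_distrib, Finset.sum_const,
      Finset.sum_ite_eq', SimpleGraph.mem_neighborFinset, SimpleGraph.card_neighborFinset_eq_degree]
    by_cases h : v = u
    · subst h; simp
    · simp [h]
      split_ifs <;> simp

/-- A cycle of length k has sign (-1)^(k-1) and its k off-diagonal entries contribute (-1)^k, which
leaves one factor -1 per cycle. -/
theorem sign_mul_prod_neg {G : SimpleGraph W} (Φ : Connection G) (σ : Perm W) :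
    ((Perm.sign σ : ℤ) : ℂ) * ∏ v ∈ σ.support, -(Φ.transport v (σ v) : ℂ) =
      ∏ c ∈ σ.cycleFactorsFinset, -(monodromy Φ c : ℂ) := by
  have hcyc : ∀ σ : Perm W, σ.IsCycle →
      ((Perm.sign σ : ℤ) : ℂ) * ∏ v ∈ σ.support, -(Φ.transport v (σ v) : ℂ) =
        -(monodromy Φ σ : ℂ) := by
    intro σ hσ
    rw [hσ.sign, Finset.prod_neg, monodromy]
    have h1 : ((-1 : ℂ) ^ σ.support.card) * (-1 : ℂ) ^ σ.support.card = 1 := by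
      rw [← mul_pow]; simp
    have h2 : ((∏ v ∈ σ.support, Φ.transport v (σ v) : Circle) : ℂ) =
        ∏ v ∈ σ.support, (Φ.transport v (σ v) : ℂ) := map_prod Circle.coeHom _ _
    rw [h2]
    push_cast
    linear_combination (-∏ v ∈ σ.support, (Φ.transport v (σ v) : ℂ)) * h1
  refine Perm.cycle_induction_on (P := fun σ => ((Perm.sign σ : ℤ) : ℂ) *
    ∏ v ∈ σ.support, -(Φ.transport v (σ v) : ℂ) =
      ∏ c ∈ σ.cycleFactorsFinset, -(monodromy Φ c : ℂ)) σ ?_ ?_ ?_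
  · simp [Perm.cycleFactorsFinset_one]
  · intro σ hσ
    rw [hσ.cycleFactorsFinset_eq_singleton, Finset.prod_singleton]
    exact hcyc σ hσ
  · intro σ τ hd hσ h1 h2
    rw [hd.cycleFactorsFinset_mul_eq_union, Finset.prod_union hd.disjoint_cycleFactorsFinset,
      ← h1, ← h2, hd.support_mul, Finset.prod_union hd.disjoint_support, Perm.sign_mul]
    have e1 : ∏ v ∈ σ.support, -(Φ.transport v ((σ * τ) v) : ℂ) =
        ∏ v ∈ σ.support, -(Φ.transport v (σ v) : ℂ) := by
      refine Finset.prod_congr rfl fun v hv => ?_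
      rw [Perm.mul_apply, (hd v).resolve_left (Perm.mem_support.mp hv)]
    have e2 : ∏ v ∈ τ.support, -(Φ.transport v ((σ * τ) v) : ℂ) =
        ∏ v ∈ τ.support, -(Φ.transport v (τ v) : ℂ) := by
      refine Finset.prod_congr rfl fun v hv => ?_
      rw [hd.commute.eq, Perm.mul_apply, (hd v).resolve_right (Perm.mem_support.mp hv)]
    rw [e1, e2]
    push_cast
    ring

/-- Each row has only two possible nonzero entries, at v and at `f v`, so a permutation contributes
only if it follows `f` wherever it moves. Such permutations correspond to sets of cycles of `f`, and
summing over all subsets expands the product of 1 - monodromy. -/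
theorem det_edgeRow {G : SimpleGraph W} (Φ : Connection G) {r : W} {f : W → W}
    (hf : f ∈ outMaps G r) :
    Matrix.det (Matrix.of fun v => edgeRow Φ r v (f v)) =
      ∏ σ ∈ followed f, (1 - (monodromy Φ σ : ℂ)) := by
  classical
  rw [mem_outMaps] at hf
  have hfv : ∀ v, v ≠ r → f v ≠ v := fun v hv => (hf.2 v hv).ne'
  -- The transpose makes each factor the entry of row v in column `σ v`, so that σ is read as
  -- following outgoing edges.
  rw [← Matrix.det_transpose, Matrix.det_apply']
  simp only [Matrix.transpose_apply, Matrix.of_apply]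
  have hterm : ∀ σ : Perm W, ((Perm.sign σ : ℤ) : ℂ) * ∏ v, edgeRow Φ r v (f v) (σ v) =
      if (∀ v ∈ σ.support, σ v = f v) then ∏ c ∈ σ.cycleFactorsFinset, -(monodromy Φ c : ℂ)
      else 0 := by
    intro σ
    split_ifs with h
    · rw [← sign_mul_prod_neg]
      congr 1
      symm
      rw [← Finset.prod_subset (Finset.subset_univ σ.support)]
      · refine Finset.prod_congr rfl fun v hv => ?_
        have h1 := h v hv
        have h2 := Perm.mem_support.mp hv
        have hvr : v ≠ r := by rintro rfl; exact h2 (h1.trans hf.1)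
        simp [edgeRow, hvr, h1, (hfv v hvr).symm]
      · intro v _ hv
        have h2 : σ v = v := by simpa using hv
        rw [h2]
        by_cases hvr : v = r
        · simp [edgeRow, hvr]
        · simp [edgeRow, hvr, hfv v hvr]
    · push Not at h
      obtain ⟨v, hv, hne⟩ := h
      have h2 := Perm.mem_support.mp hv
      rw [Finset.prod_eq_zero (Finset.mem_univ v), mul_zero]
      by_cases hvr : v = r
      · subst hvr; simp [edgeRow, h2.symm]
      · simp [edgeRow, hvr, h2.symm, hne.symm]
  rw [Finset.sum_congr rfl fun σ _ => hterm σ, ← Finset.sum_filter]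
  simp_rw [sub_eq_add_neg]
  rw [Finset.prod_one_add]
  refine Finset.sum_bij (fun σ _ => σ.cycleFactorsFinset) ?_ ?_ ?_ ?_
  · intro σ hσ
    rw [Finset.mem_filter] at hσ
    rw [Finset.mem_powerset]
    intro c hc
    have hc' := Perm.mem_cycleFactorsFinset_iff.mp hc
    refine mem_followed.mpr ⟨hc'.1, fun v hv => ?_⟩
    rw [hc'.2 v hv]
    exact hσ.2 v (Perm.mem_cycleFactorsFinset_support_le hc hv)
  · intro σ _ τ _ h
    exact Perm.cycleFactorsFinset_injective h
  · intro T hT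
    rw [Finset.mem_powerset] at hT
    have hd : (T : Set (Perm W)).Pairwise Perm.Disjoint :=
      (followed_pairwise_disjoint f).mono (by exact_mod_cast hT)
    have hcf : (T.noncommProd id (hd.imp fun _ _ => Perm.Disjoint.commute)).cycleFactorsFinset
        = T :=
      Perm.cycleFactorsFinset_eq_finset.mpr ⟨fun c hc => (mem_followed.mp (hT hc)).1, hd, rfl⟩
    refine ⟨_, ?_, hcf⟩
    rw [Finset.mem_filter]
    refine ⟨Finset.mem_univ _, fun v hv => ?_⟩
    obtain ⟨c, hc, hcv⟩ := (Perm.mem_support_iff_mem_support_of_mem_cycleFactorsFinset).mp hv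
    rw [← (Perm.mem_cycleFactorsFinset_iff.mp hc).2 v hcv]
    rw [hcf] at hc
    exact (mem_followed.mp (hT hc)).2 v hcv
  · intro σ _; rfl

/-- Multilinearity of the determinant in its rows: each row is a sum over the edges at its vertex,
and choosing one edge per row is choosing `f`. -/
theorem det_lap_eq_sum_outMaps {G : SimpleGraph W} (Φ : Connection G) (r : W) :
    (lap Φ (Finset.univ.erase r)).det =
      ∑ f ∈ outMaps G r, ∏ σ ∈ followed f, (1 - (monodromy Φ σ : ℂ)) := by
  classical
  have h : lap Φ (Finset.univ.erase r) = fun v =>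
      ∑ w ∈ (if v = r then {r} else G.neighborFinset v), edgeRow Φ r v w :=
    funext fun v => lap_row_eq_sum Φ r v
  have := MultilinearMap.map_sum_finset
    (Matrix.detRowAlternating (n := W) (R := ℂ)).toMultilinearMap
    (fun v w => edgeRow Φ r v w) (fun v => if v = r then {r} else G.neighborFinset v)
  rw [h]
  refine this.trans ?_
  refine Finset.sum_congr rfl fun f hf => det_edgeRow Φ hf

end CRSF

/-! ### Graphs of outgoing maps and their cycles -/

namespace CRSF

open Equiv

variable {W : Type*} [Fintype W] [DecidableEq W]

/-- The graph with an edge from each vertex `v` to `f v`. -/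
def followGraph (f : W → W) : SimpleGraph W := SimpleGraph.fromRel fun v w => f v = w

theorem followGraph_adj {f : W → W} {v w : W} :
    (followGraph f).Adj v w ↔ v ≠ w ∧ (f v = w ∨ f w = v) := SimpleGraph.fromRel_adj _ _ _

theorem exists_isCycle_of_list (l : List W) (hl : l.Nodup) (h2 : 2 ≤ l.length) :
    ∃ σ : Perm W, σ.IsCycle ∧ σ.support = l.toFinset ∧
      ∀ (i : ℕ) (h : i < l.length),
        σ l[i] = l[(i + 1) % l.length]'(Nat.mod_lt _ (by omega)) :=
  ⟨l.formPerm, List.isCycle_formPerm hl h2,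
    List.support_formPerm_of_nodup l hl (fun x hx => by simp [hx] at h2),
    fun i h => List.formPerm_apply_getElem l hl i h⟩

theorem sym2_inv_eq_iff {σ τ : Perm W} :
    s(σ, σ⁻¹) = s(τ, τ⁻¹) ↔ σ = τ ∨ σ = τ⁻¹ := by
  rw [Sym2.eq_iff]
  constructor
  · rintro (h | h)
    · exact Or.inl h.1
    · exact Or.inr h.1
  · rintro (rfl | rfl)
    · simp
    · simp

theorem mem_cyclesIn {Γ : SimpleGraph W} {S : Set W} {z : Sym2 (Perm W)} :
    z ∈ cyclesIn Γ S ↔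
      ∃ σ : Perm W, IsOrientedCycle Γ σ ∧ (∀ v ∈ σ.support, v ∈ S) ∧ s(σ, σ⁻¹) = z := by
  simp [cyclesIn, and_assoc]

theorem mem_cycles {Γ : SimpleGraph W} {z : Sym2 (Perm W)} :
    z ∈ cycles Γ ↔ ∃ σ : Perm W, IsOrientedCycle Γ σ ∧ s(σ, σ⁻¹) = z := by
  simp [cycles, mem_cyclesIn]

theorem perm_apply_inv_apply (σ : Perm W) (v : W) : σ (σ⁻¹ v) = v := σ.apply_symm_apply v

theorem IsOrientedCycle.inv {Γ : SimpleGraph W} {σ : Perm W} (h : IsOrientedCycle Γ σ) :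
    IsOrientedCycle Γ σ⁻¹ := by
  refine ⟨h.1.inv, by rw [Perm.support_inv]; exact h.2.1, fun v hv => ?_⟩
  have h1 := h.2.2 (σ⁻¹ v) (by rwa [← Perm.support_inv, Perm.apply_mem_support])
  rw [perm_apply_inv_apply] at h1
  exact h1.symm

theorem IsOrientedCycle.apply_ne_inv {Γ : SimpleGraph W} {σ : Perm W} (h : IsOrientedCycle Γ σ)
    {v : W} (hv : v ∈ σ.support) : σ v ≠ σ⁻¹ v := by
  intro he
  have h1 : (σ ^ 2) v = v := by
    rw [pow_two, Perm.mul_apply, he, perm_apply_inv_apply]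
  have h2 : σ ^ 2 = 1 := h.1.pow_eq_one_iff.mpr ⟨v, Perm.mem_support.mp hv, h1⟩
  have h3 := orderOf_le_of_pow_eq_one (by norm_num) h2
  rw [h.1.orderOf] at h3
  have := h.2.1
  omega

theorem IsOrientedCycle.ne_inv {Γ : SimpleGraph W} {σ : Perm W} (h : IsOrientedCycle Γ σ) :
    σ ≠ σ⁻¹ := by
  obtain ⟨v, hv⟩ : σ.support.Nonempty := Finset.card_pos.mp (by have := h.2.1; omega)
  exact fun he => h.apply_ne_inv hv (by conv_lhs => rw [he])

theorem reachable_of_mem_support {Γ : SimpleGraph W} {σ : Perm W} (h : σ.IsCycle)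
    (hadj : ∀ v ∈ σ.support, Γ.Adj v (σ v)) {u v : W} (hu : u ∈ σ.support) (hv : v ∈ σ.support) :
    Γ.Reachable u v := by
  obtain ⟨i, rfl⟩ := h.exists_pow_eq (Perm.mem_support.mp hu) (Perm.mem_support.mp hv)
  clear hv
  induction i with
  | zero => simp
  | succ k ih =>
    refine ih.trans ?_
    rw [pow_succ', Perm.mul_apply]
    exact (hadj _ (Perm.pow_apply_mem_support.mpr hu)).reachable

theorem IsOrientedCycle.mem_cyclesIn_component {Γ : SimpleGraph W} {σ : Perm W}
    (h : IsOrientedCycle Γ σ) {v : W} (hv : v ∈ σ.support) :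
    s(σ, σ⁻¹) ∈ cyclesIn Γ (Γ.connectedComponentMk v).supp := by
  refine mem_cyclesIn.mpr ⟨σ, h, fun w hw => ?_, rfl⟩
  rw [SimpleGraph.ConnectedComponent.mem_supp_iff, SimpleGraph.ConnectedComponent.eq]
  exact reachable_of_mem_support h.1 h.2.2 hw hv

/-- Each vertex emits a single edge. If one vertex of the cycle points forward along σ, the edge
joining it to its predecessor can only be emitted by the predecessor, so forwardness propagates
backwards around the whole cycle. If no vertex points forward, every edge is traversed in the other
direction. -/
theorem IsOrientedCycle.followed_or {f : W → W} {σ : Perm W}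
    (h : IsOrientedCycle (followGraph f) σ) : σ ∈ followed f ∨ σ⁻¹ ∈ followed f := by
  by_cases hex : ∃ u ∈ σ.support, f u = σ u
  · left
    obtain ⟨u, hu, hfu⟩ := hex
    refine mem_followed.mpr ⟨h.1, fun v hv => ?_⟩
    obtain ⟨i, rfl⟩ := h.1.inv.exists_pow_eq (x := u) (y := v)
      (by rwa [← Perm.mem_support, Perm.support_inv])
      (by rwa [← Perm.mem_support, Perm.support_inv])
    clear hv
    induction i with
    | zero => simpa using hfu.symm
    | succ k ih =>
      set w := (σ⁻¹ ^ k) u with hw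
      have hws : w ∈ σ.support := by
        rw [← Perm.support_inv] at hu ⊢
        exact Perm.pow_apply_mem_support.mpr hu
      have hws' : σ⁻¹ w ∈ σ.support := by
        rw [← Perm.support_inv] at hws ⊢
        exact Perm.apply_mem_support.mpr hws
      have hadj := h.2.2 _ hws'
      rw [pow_succ', Perm.mul_apply, ← hw]
      rw [perm_apply_inv_apply] at hadj ⊢
      rcases (followGraph_adj.mp hadj).2 with h1 | h1
      · exact h1.symm
      · exact absurd (ih.trans h1) (h.apply_ne_inv hws)
  · right
    push Not at hex
    refine mem_followed.mpr ⟨h.1.inv, fun v hv => ?_⟩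
    rw [Perm.support_inv] at hv
    have hv' : σ⁻¹ v ∈ σ.support := by
      rw [← Perm.support_inv] at hv ⊢
      exact Perm.apply_mem_support.mpr hv
    have hadj := h.2.2 _ hv'
    have hne := hex _ hv'
    rw [perm_apply_inv_apply] at hadj hne
    exact ((followGraph_adj.mp hadj).2.resolve_left hne).symm

theorem isOrientedCycle_followGraph {f : W → W} {σ : Perm W} (h : σ ∈ followed f)
    (h3 : 3 ≤ σ.support.card) : IsOrientedCycle (followGraph f) σ := by
  rw [mem_followed] at h
  exact ⟨h.1, h3, fun v hv => followGraph_adj.mpr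
    ⟨(Perm.mem_support.mp hv).symm, Or.inl (h.2 v hv).symm⟩⟩

theorem followed_adj {f : W → W} {σ : Perm W} (h : σ ∈ followed f) :
    ∀ v ∈ σ.support, (followGraph f).Adj v (σ v) := fun v hv =>
  followGraph_adj.mpr ⟨(Perm.mem_support.mp hv).symm, Or.inl ((mem_followed.mp h).2 v hv).symm⟩

theorem iterate_mem_support {f : W → W} {σ : Perm W} (h : σ ∈ followed f) {v : W}
    (hv : v ∈ σ.support) (i : ℕ) : f^[i] v ∈ σ.support := by
  induction i with
  | zero => exact hv
  | succ k ih =>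
    rw [Function.iterate_succ_apply', ← (mem_followed.mp h).2 _ ih]
    exact Perm.apply_mem_support.mpr ih

theorem followGraph_reachable_iterate (f : W → W) (v : W) (i : ℕ) :
    (followGraph f).Reachable v (f^[i] v) := by
  induction i with
  | zero => simp
  | succ k ih =>
    refine ih.trans ?_
    rw [Function.iterate_succ_apply']
    by_cases h : f^[k] v = f (f^[k] v)
    · rw [← h]
    · exact (followGraph_adj.mpr ⟨h, Or.inl rfl⟩ : (followGraph f).Adj _ _).reachable

theorem exists_iterate_eq_of_reachable {f : W → W} {u v : W}
    (h : (followGraph f).Reachable u v) : ∃ i j, f^[i] u = f^[j] v := by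
  obtain ⟨p⟩ := h
  induction p with
  | nil => exact ⟨0, 0, rfl⟩
  | cons hadj p ih =>
    obtain ⟨i, j, hij⟩ := ih
    rcases (followGraph_adj.mp hadj).2 with h1 | h1
    · refine ⟨i + 1, j, ?_⟩
      rw [Function.iterate_succ_apply, h1, hij]
    · refine ⟨i, j + 1, ?_⟩
      rw [← h1, ← Function.iterate_succ_apply, Function.iterate_succ_apply', hij,
        Function.iterate_succ_apply']

/-- The orbit is eventually periodic by finiteness, and its period is at least 2 because `r` is the
only fixed point. -/
theorem exists_followed_of_iterate_ne {G : SimpleGraph W} {r : W} {f : W → W}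
    (hf : f ∈ outMaps G r) {v : W} (hv : ∀ i, f^[i] v ≠ r) :
    ∃ σ ∈ followed f, ∃ i, f^[i] v ∈ σ.support := by
  rw [mem_outMaps] at hf
  obtain ⟨a, b, hab, he⟩ : ∃ a b : ℕ, a < b ∧ f^[a] v = f^[b] v := by
    obtain ⟨a, b, hne, he⟩ := Finite.exists_ne_map_eq_of_infinite fun i : ℕ => f^[i] v
    rcases lt_or_gt_of_ne hne with h | h
    · exact ⟨a, b, h, he⟩
    · exact ⟨b, a, h, he.symm⟩
  set u := f^[a] v with hu
  have hper : u ∈ Function.periodicPts f := by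
    refine Function.mk_mem_periodicPts (n := b - a) (by omega) ?_
    rw [Function.IsPeriodicPt, Function.IsFixedPt, hu, ← Function.iterate_add_apply,
      Nat.sub_add_cancel hab.le, ← he]
  have hpos := Function.minimalPeriod_pos_of_mem_periodicPts hper
  set m := Function.minimalPeriod f u with hm
  have hfu : f u ≠ u := (hf.2 u (hv a)).ne'
  have hm2 : 2 ≤ m := by
    by_contra hlt
    have h1 : m = 1 := by omega
    exact hfu (Function.minimalPeriod_eq_one_iff_isFixedPt.mp (hm.symm.trans h1))
  set l := (List.range m).map fun i => f^[i] u with hl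
  have hlen : l.length = m := by simp [hl]
  have hnd : l.Nodup := by
    rw [hl]
    refine List.Nodup.map_on ?_ List.nodup_range
    intro x hx y hy hxy
    rw [List.mem_range] at hx hy
    exact Function.iterate_injOn_Iio_minimalPeriod hx hy hxy
  obtain ⟨σ, hσ, hsupp, hstep⟩ := exists_isCycle_of_list l hnd (by omega)
  refine ⟨σ, mem_followed.mpr ⟨hσ, fun w hw => ?_⟩, a, ?_⟩
  · rw [hsupp, List.mem_toFinset] at hw
    obtain ⟨i, hi, rfl⟩ := List.getElem_of_mem hw
    rw [hstep i hi]
    simp only [hl, List.getElem_map, List.getElem_range, List.length_map, List.length_range]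
    rw [hm, Function.iterate_mod_minimalPeriod_eq, Function.iterate_succ_apply']
  · rw [hsupp, List.mem_toFinset, ← hu, hl, List.mem_map]
    exact ⟨0, List.mem_range.mpr hpos, rfl⟩

theorem followGraph_le {G : SimpleGraph W} {r : W} {f : W → W} (hf : f ∈ outMaps G r) :
    followGraph f ≤ G := by
  rw [mem_outMaps] at hf
  intro v w h
  obtain ⟨hne, h | h⟩ := followGraph_adj.mp h
  · have : v ≠ r := by rintro rfl; exact hne (hf.1.symm.trans h)
    exact h ▸ hf.2 v this
  · have : w ≠ r := by rintro rfl; exact hne (h.symm.trans hf.1)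
    exact (h ▸ hf.2 w this).symm

theorem not_mem_support_followed {G : SimpleGraph W} {r : W} {f : W → W} (hf : f ∈ outMaps G r)
    {σ : Perm W} (hσ : σ ∈ followed f) : r ∉ σ.support := fun h =>
  Perm.mem_support.mp h (((mem_followed.mp hσ).2 r h).trans (mem_outMaps.mp hf).1)

theorem iterate_root {G : SimpleGraph W} {r : W} {f : W → W} (hf : f ∈ outMaps G r) (i : ℕ) :
    f^[i] r = r := Function.iterate_fixed (mem_outMaps.mp hf).1 i

theorem not_reachable_root {G : SimpleGraph W} {r : W} {f : W → W} (hf : f ∈ outMaps G r)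
    {σ : Perm W} (hσ : σ ∈ followed f) {v : W} (hv : v ∈ σ.support) :
    ¬ (followGraph f).Reachable v r := by
  intro h
  obtain ⟨i, j, hij⟩ := exists_iterate_eq_of_reachable h
  rw [iterate_root hf] at hij
  exact not_mem_support_followed hf hσ (hij ▸ iterate_mem_support hσ hv i)

theorem followed_eq_of_reachable {f : W → W} {σ τ : Perm W} (hσ : σ ∈ followed f)
    (hτ : τ ∈ followed f) {u v : W} (hu : u ∈ σ.support) (hv : v ∈ τ.support)
    (h : (followGraph f).Reachable u v) : σ = τ := by
  obtain ⟨i, j, hij⟩ := exists_iterate_eq_of_reachable h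
  exact followed_eq_of_mem hσ hτ (iterate_mem_support hσ hu i)
    (hij ▸ iterate_mem_support hτ hv j)

theorem IsOrientedCycle.exists_followed {f : W → W} {σ : Perm W}
    (h : IsOrientedCycle (followGraph f) σ) :
    ∃ τ ∈ followed f, τ.support = σ.support ∧ s(τ, τ⁻¹) = s(σ, σ⁻¹) := by
  rcases h.followed_or with h1 | h1
  · exact ⟨σ, h1, rfl, rfl⟩
  · exact ⟨σ⁻¹, h1, Perm.support_inv σ, sym2_inv_eq_iff.mpr (Or.inr rfl)⟩

/-- Orbits merge inside a component, so each component has exactly one terminal state: the root or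
one followed cycle. Every graph cycle is a followed one up to orientation. The length condition
excludes two vertices pointing at each other, whose edge is no cycle of the graph. -/
theorem isEssential_followGraph {G : SimpleGraph W} {r : W} {f : W → W} (hf : f ∈ outMaps G r)
    (h3 : ∀ σ ∈ followed f, 3 ≤ σ.support.card) : IsEssential G r (followGraph f) := by
  refine ⟨followGraph_le hf, fun C => ⟨fun hr => ?_, fun hr => ?_⟩⟩
  · rw [Finset.card_eq_zero, Finset.eq_empty_iff_forall_notMem]
    intro z hz
    obtain ⟨σ, hσ, hS, -⟩ := mem_cyclesIn.mp hz
    obtain ⟨τ, hτ, hs, -⟩ := hσ.exists_followed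
    obtain ⟨v, hv⟩ : σ.support.Nonempty := Finset.card_pos.mp (by have := hσ.2.1; omega)
    exact not_reachable_root hf hτ (hs ▸ hv)
      (SimpleGraph.ConnectedComponent.exact ((hS v hv).trans hr.symm))
  · obtain ⟨v, hv⟩ := C.exists_rep
    have hv' : (followGraph f).connectedComponentMk v = C := hv
    have hne : ∀ i, f^[i] v ≠ r := by
      intro i hi
      apply hr
      rw [SimpleGraph.ConnectedComponent.mem_supp_iff, ← hv', SimpleGraph.ConnectedComponent.eq]
      exact (hi ▸ followGraph_reachable_iterate f v i).symm
    obtain ⟨σ, hσ, i, hi⟩ := exists_followed_of_iterate_ne hf hne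
    have hσ' := isOrientedCycle_followGraph hσ (h3 σ hσ)
    have hC : (followGraph f).connectedComponentMk (f^[i] v) = C := by
      rw [← hv', SimpleGraph.ConnectedComponent.eq]
      exact (followGraph_reachable_iterate f v i).symm
    rw [Finset.card_eq_one]
    refine ⟨s(σ, σ⁻¹), Finset.eq_singleton_iff_unique_mem.mpr
      ⟨hC ▸ hσ'.mem_cyclesIn_component hi, fun z hz => ?_⟩⟩
    obtain ⟨ρ, hρ, hS, rfl⟩ := mem_cyclesIn.mp hz
    obtain ⟨τ, hτ, hs, he⟩ := hρ.exists_followed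
    obtain ⟨w, hw⟩ : ρ.support.Nonempty := Finset.card_pos.mp (by have := hρ.2.1; omega)
    rw [← he, followed_eq_of_reachable hτ hσ (hs ▸ hw) hi
      (SimpleGraph.ConnectedComponent.exact ((hS w hw).trans hC.symm))]

/-- The component avoids the root, so it contains a genuine graph cycle; that cycle is followed up
to orientation, and a component has only one followed cycle. -/
theorem three_le_card_of_isEssential {G : SimpleGraph W} {r : W} {f : W → W}
    (hf : f ∈ outMaps G r) (hess : IsEssential G r (followGraph f)) {σ : Perm W}
    (hσ : σ ∈ followed f) : 3 ≤ σ.support.card := by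
  obtain ⟨v, hv⟩ : σ.support.Nonempty :=
    Finset.card_pos.mp (by have := (mem_followed.mp hσ).1.two_le_card_support; omega)
  have hr : r ∉ ((followGraph f).connectedComponentMk v).supp := by
    rw [SimpleGraph.ConnectedComponent.mem_supp_iff, SimpleGraph.ConnectedComponent.eq]
    exact fun h => not_reachable_root hf hσ hv h.symm
  obtain ⟨z, hz⟩ := Finset.card_eq_one.mp ((hess.2 _).2 hr)
  obtain ⟨ρ, hρ, hS, -⟩ := mem_cyclesIn.mp (hz ▸ Finset.mem_singleton_self z)
  obtain ⟨τ, hτ, hs, he⟩ := hρ.exists_followed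
  obtain ⟨w, hw⟩ : ρ.support.Nonempty := Finset.card_pos.mp (by have := hρ.2.1; omega)
  rw [← followed_eq_of_reachable hτ hσ (hs ▸ hw) hv
    (SimpleGraph.ConnectedComponent.exact (hS w hw)), hs]
  exact hρ.2.1

/-- Running along an edge and back has monodromy 1, so maps with a 2-cycle drop out of the
expansion. -/
theorem one_sub_monodromy_eq_zero {G : SimpleGraph W} (Φ : Connection G) {r : W} {f : W → W}
    (hf : f ∈ outMaps G r) {σ : Perm W} (hσ : σ ∈ followed f) (h3 : ¬ 3 ≤ σ.support.card) :
    1 - (monodromy Φ σ : ℂ) = 0 := by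
  have h2 : σ.support.card = 2 := by
    have := (mem_followed.mp hσ).1.two_le_card_support
    omega
  obtain ⟨x, y, hne, rfl⟩ := Perm.card_support_eq_two.mp h2
  have hx : x ∈ (swap x y).support := by rw [Perm.support_swap hne]; simp
  have hxr : x ≠ r := by rintro rfl; exact not_mem_support_followed hf hσ hx
  have hfx : f x = y := by
    rw [← (mem_followed.mp hσ).2 x hx, swap_apply_left]
  have hadj : G.Adj x y := hfx ▸ (mem_outMaps.mp hf).2 x hxr
  rw [monodromy, Perm.support_swap hne, Finset.prod_pair hne, swap_apply_left, swap_apply_right,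
    Φ.transport_symm x y hadj]
  simp

/-- The graph and the orientation of its cycles determine the map. If f and g differ at u, the edge
from u to `f u` must be emitted by g from `f u`, and then they differ at `f u` as well, since
otherwise f would follow a 2-cycle that g does not. The disagreement travels along the orbit until
it reaches the root or a followed cycle, where the two maps agree. -/
theorem outMaps_ext {G : SimpleGraph W} {r : W} {f g : W → W} (hf : f ∈ outMaps G r)
    (hg : g ∈ outMaps G r) (hfg : followGraph f = followGraph g)
    (hfol : ∀ σ ∈ followed f, σ ∈ followed g) : f = g := by
  by_contra hne
  obtain ⟨v, hv⟩ := Function.ne_iff.mp hne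
  have hstep : ∀ u, f u ≠ g u → f (f u) ≠ g (f u) := by
    intro u hu he
    have hur : u ≠ r := by
      rintro rfl
      exact hu ((mem_outMaps.mp hf).1.trans (mem_outMaps.mp hg).1.symm)
    have hne' : u ≠ f u := ((mem_outMaps.mp hf).2 u hur).ne
    have hadj : (followGraph f).Adj u (f u) := followGraph_adj.mpr ⟨hne', Or.inl rfl⟩
    rw [hfg, followGraph_adj] at hadj
    have hgw : g (f u) = u := hadj.2.resolve_left fun h => hu h.symm
    have hsw : swap u (f u) ∈ followed f := by
      refine mem_followed.mpr ⟨Perm.isCycle_swap hne', fun w hw => ?_⟩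
      rw [Perm.support_swap hne', Finset.mem_insert, Finset.mem_singleton] at hw
      rcases hw with rfl | rfl
      · rw [swap_apply_left]
      · rw [swap_apply_right, he, hgw]
    have := (mem_followed.mp (hfol _ hsw)).2 u (by rw [Perm.support_swap hne']; simp)
    rw [swap_apply_left] at this
    exact hu this
  have hall : ∀ i, f (f^[i] v) ≠ g (f^[i] v) := by
    intro i
    induction i with
    | zero => exact hv
    | succ k ih => rw [Function.iterate_succ_apply']; exact hstep _ ih
  have hnr : ∀ i, f^[i] v ≠ r := by
    intro i hi
    apply hall i
    rw [hi, (mem_outMaps.mp hf).1, (mem_outMaps.mp hg).1]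
  obtain ⟨σ, hσ, i, hi⟩ := exists_followed_of_iterate_ne hf hnr
  apply hall i
  rw [← (mem_followed.mp hσ).2 _ hi, ← (mem_followed.mp (hfol σ hσ)).2 _ hi]

theorem exists_isOrientedCycle_of_path {Γ : SimpleGraph W} {u w : W} (p : Γ.Walk w u)
    (hp : p.IsPath) (hadj : Γ.Adj u w) (h2 : 2 ≤ p.length) :
    ∃ σ : Perm W, IsOrientedCycle Γ σ ∧ u ∈ σ.support ∧ σ u = w := by
  have hlen : p.support.length = p.length + 1 := SimpleGraph.Walk.length_support p
  obtain ⟨σ, hσ, hsupp, hstep⟩ := exists_isCycle_of_list p.support hp.support_nodup (by omega)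
  have hget : ∀ i (h : i < p.support.length), p.support[i] = p.getVert i := by
    intro i h
    rw [SimpleGraph.Walk.getVert_eq_support_getElem p (by omega)]
  have hlast : σ u = w := by
    have := hstep p.length (by omega)
    rw [hget, hget, SimpleGraph.Walk.getVert_length] at this
    rw [this, hlen, Nat.mod_self, SimpleGraph.Walk.getVert_zero]
  refine ⟨σ, ⟨hσ, ?_, fun v hv => ?_⟩, ?_, hlast⟩
  · rw [hsupp, List.toFinset_card_of_nodup hp.support_nodup]; omega
  · rw [hsupp, List.mem_toFinset] at hv
    obtain ⟨i, hi, rfl⟩ := List.getElem_of_mem hv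
    by_cases hil : i = p.length
    · rw [hget i hi, hil, SimpleGraph.Walk.getVert_length, hlast]; exact hadj
    · rw [hstep i hi, hget, hget, Nat.mod_eq_of_lt (by omega)]
      exact p.adj_getVert_succ (by omega)
  · rw [hsupp, List.mem_toFinset]; exact p.end_mem_support

end CRSF

/-! ### The matrix-tree theorem for connections -/

namespace CRSF

open Equiv

variable {W : Type*} [Fintype W] [DecidableEq W]

theorem exists_isOrientedCycle_through_edge {Γ Γ' : SimpleGraph W} (hle : Γ' ≤ Γ) {u w : W}
    (hreach : Γ'.Reachable w u) (hadj : Γ.Adj u w) (hnot : ¬ Γ'.Adj u w) :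
    ∃ σ : Perm W, IsOrientedCycle Γ σ ∧ u ∈ σ.support ∧ σ u = w := by
  obtain ⟨q⟩ := hreach
  obtain ⟨p, hp⟩ := q.toPath
  have h2 : 2 ≤ p.length := by
    by_contra hlt
    have : p.length = 0 ∨ p.length = 1 := by omega
    rcases this with h | h
    · exact hadj.ne (SimpleGraph.Walk.eq_of_length_eq_zero h).symm
    · exact hnot (SimpleGraph.Walk.adj_of_length_eq_one h).symm
  refine exists_isOrientedCycle_of_path (p.mapLe hle) ?_ hadj (by simpa using h2)
  exact (SimpleGraph.Walk.isPath_mapLe hle).mpr hp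

/-- On each cycle the map follows the prescribed orientation; elsewhere it moves one step closer, in
graph distance, to a base point of the component lying on the cycle or equal to `r`. -/
theorem exists_outMap_of_orientation {G : SimpleGraph W} {r : W} {Γ : SimpleGraph W}
    (hess : IsEssential G r Γ) (o : {z // z ∈ cycles Γ} → Perm W)
    (ho : ∀ z, s(o z, (o z)⁻¹) = z.1) :
    ∃ f ∈ outMaps G r, followGraph f = Γ ∧ ∀ z, o z ∈ followed f := by
  classical
  have hcyc : ∀ z, IsOrientedCycle Γ (o z) := by
    intro z
    obtain ⟨σ, hσ, he⟩ := mem_cycles.mp z.2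
    rcases sym2_inv_eq_iff.mp (he.trans (ho z).symm) with h | h
    · exact h ▸ hσ
    · have := hσ.inv
      rwa [h, inv_inv] at this
  have hr : ∀ z, ∀ v ∈ (o z).support, ¬ Γ.Reachable r v := by
    intro z v hv hrv
    have h1 := (hcyc z).mem_cyclesIn_component hv
    have h2 := (hess.2 (Γ.connectedComponentMk v)).1
      ((SimpleGraph.ConnectedComponent.mem_supp_iff _ _).mpr
        (SimpleGraph.ConnectedComponent.eq.mpr hrv))
    rw [Finset.card_eq_zero] at h2
    rw [h2] at h1
    exact absurd h1 (Finset.notMem_empty _)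
  have huniq : ∀ z z' : {z // z ∈ cycles Γ}, ∀ v ∈ (o z).support, ∀ v' ∈ (o z').support,
      Γ.Reachable v v' → z = z' := by
    intro z z' v hv v' hv' hvv
    have h1 := (hcyc z).mem_cyclesIn_component hv
    have h2 := (hcyc z').mem_cyclesIn_component hv'
    rw [← SimpleGraph.ConnectedComponent.eq.mpr hvv] at h2
    have hnr : r ∉ (Γ.connectedComponentMk v).supp := by
      rw [SimpleGraph.ConnectedComponent.mem_supp_iff, SimpleGraph.ConnectedComponent.eq]
      exact hr z v hv
    have h3 := Finset.card_le_one.mp ((hess.2 _).2 hnr).le _ h1 _ h2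
    rw [ho, ho] at h3
    exact Subtype.ext h3
  have hbase : ∀ C : Γ.ConnectedComponent, ∃ b ∈ C.supp, b = r ∨ ∃ z, b ∈ (o z).support := by
    intro C
    by_cases hrC : r ∈ C.supp
    · exact ⟨r, hrC, Or.inl rfl⟩
    · obtain ⟨z, hz⟩ := Finset.card_eq_one.mp ((hess.2 C).2 hrC)
      obtain ⟨σ, hσ, hS, he⟩ := mem_cyclesIn.mp (hz ▸ Finset.mem_singleton_self z)
      have hzc : z ∈ cycles Γ := mem_cycles.mpr ⟨σ, hσ, he⟩
      obtain ⟨v, hv⟩ : σ.support.Nonempty := Finset.card_pos.mp (by have := hσ.2.1; omega)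
      refine ⟨v, hS v hv, Or.inr ⟨⟨z, hzc⟩, ?_⟩⟩
      rcases sym2_inv_eq_iff.mp (he.trans (ho ⟨z, hzc⟩).symm) with h | h
      · exact h ▸ hv
      · rw [h, Perm.support_inv] at hv; exact hv
  choose base hbase_mem hbase_root using hbase
  have hreach : ∀ v, Γ.Reachable v (base (Γ.connectedComponentMk v)) := fun v =>
    SimpleGraph.ConnectedComponent.eq.mp
      ((SimpleGraph.ConnectedComponent.mem_supp_iff _ _).mp
        (hbase_mem (Γ.connectedComponentMk v))).symm
  -- This distance is the potential that decreases along `f` until the orbit meets the root or any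
  -- vertex of a cycle.
  set d : W → ℕ := fun v => Γ.dist v (base (Γ.connectedComponentMk v)) with hd
  have hnext : ∀ v, ∃ u, ¬ (v = r ∨ ∃ z, v ∈ (o z).support) → Γ.Adj v u ∧ d u < d v := by
    intro v
    by_cases hv : v = r ∨ ∃ z, v ∈ (o z).support
    · exact ⟨v, fun h => absurd hv h⟩
    · obtain ⟨p, hp⟩ := (hreach v).exists_walk_length_eq_dist
      have hne : v ≠ base (Γ.connectedComponentMk v) := fun h => hv (h ▸ hbase_root _)
      generalize hb : base (Γ.connectedComponentMk v) = b at p hp hne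
      cases p with
      | nil => exact absurd rfl hne
      | @cons _ u _ hadj q =>
        refine ⟨u, fun _ => ⟨hadj, ?_⟩⟩
        have hc : Γ.connectedComponentMk u = Γ.connectedComponentMk v :=
          SimpleGraph.ConnectedComponent.eq.mpr hadj.symm.reachable
        simp only [hd, hc, hb]
        rw [← hp, SimpleGraph.Walk.length_cons]
        exact Nat.lt_succ_of_le (SimpleGraph.dist_le q)
  choose next hnext using hnext
  set f : W → W := fun v => if h : ∃ z, v ∈ (o z).support then o h.choose v
    else if v = r then r else next v with hf
  have hf_cyc : ∀ z, ∀ v ∈ (o z).support, f v = o z v := by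
    intro z v hv
    have hex : ∃ z, v ∈ (o z).support := ⟨z, hv⟩
    have : hex.choose = z := huniq _ _ v hex.choose_spec v hv (SimpleGraph.Reachable.refl v)
    simp only [hf, dif_pos hex, this]
  have hf_root : f r = r := by
    have hno : ¬ ∃ z, r ∈ (o z).support := fun ⟨z, hz⟩ => hr z r hz (SimpleGraph.Reachable.refl r)
    simp only [hf, dif_neg hno, if_true]
  have hf_next : ∀ v, ¬ (v = r ∨ ∃ z, v ∈ (o z).support) → f v = next v := by
    intro v hv
    push Not at hv
    have hno : ¬ ∃ z, v ∈ (o z).support := fun ⟨z, hz⟩ => hv.2 z hz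
    simp only [hf, dif_neg hno, if_neg hv.1]
  have hf_adj : ∀ v, v ≠ r → Γ.Adj v (f v) := by
    intro v hv
    by_cases hex : ∃ z, v ∈ (o z).support
    · obtain ⟨z, hz⟩ := hex
      rw [hf_cyc z v hz]
      exact (hcyc z).2.2 v hz
    · have : ¬ (v = r ∨ ∃ z, v ∈ (o z).support) := not_or.mpr ⟨hv, hex⟩
      rw [hf_next v this]
      exact (hnext v this).1
  have hmem : f ∈ outMaps G r := mem_outMaps.mpr ⟨hf_root, fun v hv => hess.1 (hf_adj v hv)⟩
  have hfol : ∀ z, o z ∈ followed f := fun z =>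
    mem_followed.mpr ⟨(hcyc z).1, fun v hv => (hf_cyc z v hv).symm⟩
  have hle : followGraph f ≤ Γ := followGraph_le (mem_outMaps.mpr ⟨hf_root, hf_adj⟩)
  refine ⟨f, hmem, le_antisymm hle ?_, hfol⟩
  have hend : ∀ k v, d v ≤ k → ∃ b, (followGraph f).Reachable v b ∧
      (b = r ∨ ∃ z, b ∈ (o z).support) := by
    intro k
    induction k with
    | zero =>
      intro v hv
      by_cases h : v = r ∨ ∃ z, v ∈ (o z).support
      · exact ⟨v, SimpleGraph.Reachable.refl v, h⟩
      · have := (hnext v h).2; omega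
    | succ k ih =>
      intro v hv
      by_cases h : v = r ∨ ∃ z, v ∈ (o z).support
      · exact ⟨v, SimpleGraph.Reachable.refl v, h⟩
      · obtain ⟨b, hb, hb'⟩ := ih (f v) (by rw [hf_next v h]; have := (hnext v h).2; omega)
        exact ⟨b, (followGraph_reachable_iterate f v 1).trans hb, hb'⟩
  have hconn : ∀ u w, Γ.Reachable u w → (followGraph f).Reachable u w := by
    intro u w huw
    obtain ⟨b, hb, hb'⟩ := hend _ u le_rfl
    obtain ⟨b', hbw, hbw'⟩ := hend _ w le_rfl
    have hbb : Γ.Reachable b b' := ((hb.mono hle).symm.trans huw).trans (hbw.mono hle)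
    refine (hb.trans ?_).trans hbw.symm
    rcases hb' with rfl | ⟨z, hz⟩
    · rcases hbw' with rfl | ⟨z', hz'⟩
      · exact SimpleGraph.Reachable.refl _
      · exact absurd hbb (hr z' b' hz')
    · rcases hbw' with rfl | ⟨z', hz'⟩
      · exact absurd hbb.symm (hr z b hz)
      · obtain rfl := huniq z z' b hz b' hz' hbb
        exact reachable_of_mem_support (hcyc z).1 (followed_adj (hfol z)) hz hz'
  -- An edge of Γ not used by `f` would close a cycle of Γ through itself, since `followGraph f`
  -- already connects its ends. That cycle is one of the oriented ones, all of whose edges `f` uses.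
  intro u w hadj
  by_contra hnot
  obtain ⟨σ, hσ, hu, huw⟩ :=
    exists_isOrientedCycle_through_edge hle (hconn w u hadj.symm.reachable) hadj hnot
  have hz : s(σ, σ⁻¹) ∈ cycles Γ := mem_cycles.mpr ⟨σ, hσ, rfl⟩
  rcases sym2_inv_eq_iff.mp (ho ⟨_, hz⟩) with h | h
  · apply hnot
    have := followed_adj (hfol ⟨_, hz⟩) u (by rw [h]; exact hu)
    rwa [h, huw] at this
  · apply hnot
    have hw : w ∈ (o ⟨_, hz⟩).support := by
      rw [h, Perm.support_inv, ← huw]; exact Perm.apply_mem_support.mpr hu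
    have := followed_adj (hfol ⟨_, hz⟩) w hw
    have e : σ⁻¹ w = u := by rw [← huw]; exact σ.symm_apply_apply u
    rw [h, e] at this
    exact this.symm

theorem coe_cycleWeight {G : SimpleGraph W} (Φ : Connection G) {σ : Perm W}
    (hσ : IsOrientedCycle G σ) :
    (cycleWeight Φ s(σ, σ⁻¹) : ℂ) =
      (1 - (monodromy Φ σ : ℂ)) + (1 - (monodromy Φ σ⁻¹ : ℂ)) := by
  have h : (monodromy Φ σ⁻¹ : ℂ) = (starRingEnd ℂ) (monodromy Φ σ : ℂ) := by
    rw [monodromy_inv Φ hσ, Circle.coe_inv_eq_conj]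
  have h1 : ((monodromy Φ σ⁻¹ : ℂ)).re = ((monodromy Φ σ : ℂ)).re := by rw [h, Complex.conj_re]
  simp only [cycleWeight, Sym2.lift_mk]
  rw [h1, h]
  have := Complex.add_conj (monodromy Φ σ : ℂ)
  push_cast at this ⊢
  linear_combination this

-- The maps with graph Γ correspond to independent choices of an orientation for each cycle.
-- Opposite orientations contribute (1 - e^{iθ}) + (1 - e^{-iθ}) = 2 - 2 cos θ, so the sum factors
-- into the weight.
open Classical in
theorem sum_fiber_eq_weight {G : SimpleGraph W} (Φ : Connection G) {r : W} {Γ : SimpleGraph W}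
    (hess : IsEssential G r Γ) :
    ∑ f ∈ outMaps G r with followGraph f = Γ, ∏ σ ∈ followed f, (1 - (monodromy Φ σ : ℂ)) =
      (weight Φ Γ : ℂ) := by
  set t : {z // z ∈ cycles Γ} → Finset (Perm W) := fun z =>
    Finset.univ.filter fun σ => s(σ, σ⁻¹) = z.1 with ht
  have hw : (weight Φ Γ : ℂ) = ∏ z : {z // z ∈ cycles Γ}, ∑ σ ∈ t z, (1 - (monodromy Φ σ : ℂ)) := by
    rw [weight, Complex.ofReal_prod, ← Finset.prod_coe_sort]
    refine Finset.prod_congr rfl fun z _ => ?_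
    obtain ⟨σ, hσ, he⟩ := mem_cycles.mp z.2
    have : t z = {σ, σ⁻¹} := by
      ext τ
      simp only [ht, Finset.mem_filter, Finset.mem_univ, true_and, Finset.mem_insert,
        Finset.mem_singleton]
      rw [← he, sym2_inv_eq_iff]
    rw [this, Finset.sum_pair hσ.ne_inv, ← he]
    exact coe_cycleWeight Φ ⟨hσ.1, hσ.2.1, fun v hv => hess.1 (hσ.2.2 v hv)⟩
  rw [hw, Finset.prod_univ_sum]
  have hchoice : ∀ f : W → W, ∃ p : {z // z ∈ cycles Γ} → Perm W,
      followGraph f = Γ → ∀ z, p z ∈ followed f ∧ s(p z, (p z)⁻¹) = z.1 := by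
    intro f
    by_cases hf : followGraph f = Γ
    · have : ∀ z : {z // z ∈ cycles Γ}, ∃ τ ∈ followed f, s(τ, τ⁻¹) = z.1 := by
        intro z
        obtain ⟨σ, hσ, he⟩ := mem_cycles.mp z.2
        rw [← hf] at hσ
        obtain ⟨τ, hτ, -, he'⟩ := hσ.exists_followed
        exact ⟨τ, hτ, he'.trans he⟩
      choose p hp using this
      exact ⟨p, fun _ => hp⟩
    · exact ⟨fun _ => 1, fun h => absurd h hf⟩
  choose P hP using hchoice
  have hsurj : ∀ f ∈ outMaps G r, followGraph f = Γ → ∀ σ ∈ followed f, ∃ z, P f z = σ := by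
    intro f hf hΓ σ hσ
    have h3 := three_le_card_of_isEssential hf (hΓ ▸ hess) hσ
    have hz : s(σ, σ⁻¹) ∈ cycles Γ :=
      mem_cycles.mpr ⟨σ, hΓ ▸ isOrientedCycle_followGraph hσ h3, rfl⟩
    refine ⟨⟨_, hz⟩, ?_⟩
    obtain ⟨h1, h2⟩ := hP f hΓ ⟨_, hz⟩
    obtain ⟨v, hv⟩ : σ.support.Nonempty := Finset.card_pos.mp (by omega)
    refine followed_eq_of_mem h1 hσ (v := v) ?_ hv
    rcases sym2_inv_eq_iff.mp h2 with h | h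
    · rw [h]; exact hv
    · rw [h, Perm.support_inv]; exact hv
  refine Finset.sum_bij (fun f _ => P f) ?_ ?_ ?_ ?_
  · intro f hf
    rw [Finset.mem_filter] at hf
    rw [Fintype.mem_piFinset]
    intro z
    simpa [ht] using (hP f hf.2 z).2
  · intro f hf g hg hfg
    rw [Finset.mem_filter] at hf hg
    refine outMaps_ext hf.1 hg.1 (hf.2.trans hg.2.symm) fun σ hσ => ?_
    obtain ⟨z, rfl⟩ := hsurj f hf.1 hf.2 σ hσ
    have hfg' : P f = P g := hfg
    rw [hfg']
    exact (hP g hg.2 z).1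
  · intro p hp
    rw [Fintype.mem_piFinset] at hp
    have hp' : ∀ z, s(p z, (p z)⁻¹) = z.1 := fun z => by simpa [ht] using hp z
    obtain ⟨f, hf, hΓ, hfol⟩ := exists_outMap_of_orientation hess p hp'
    refine ⟨f, Finset.mem_filter.mpr ⟨hf, hΓ⟩, funext fun z => ?_⟩
    obtain ⟨h1, h2⟩ := hP f hΓ z
    have hτ := mem_followed.mp h1
    obtain ⟨v, hv⟩ : (P f z).support.Nonempty :=
      Finset.card_pos.mp (by have := hτ.1.two_le_card_support; omega)
    refine followed_eq_of_mem h1 (hfol z) hv ?_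
    rcases sym2_inv_eq_iff.mp (h2.trans (hp' z).symm) with h | h
    · exact h ▸ hv
    · rw [h, Perm.support_inv] at hv; exact hv
  · intro f hf
    rw [Finset.mem_filter] at hf
    symm
    refine Finset.prod_bij (fun z _ => P f z) (fun z _ => (hP f hf.2 z).1) ?_ ?_ (fun _ _ => rfl)
    · intro z _ z' _ h
      have h' : P f z = P f z' := h
      refine Subtype.ext ?_
      rw [← (hP f hf.2 z).2, ← (hP f hf.2 z').2, h']
    · intro σ hσ
      obtain ⟨z, hz⟩ := hsurj f hf.1 hf.2 σ hσ
      exact ⟨z, Finset.mem_univ _, hz⟩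

/-- The matrix-tree theorem for connections with Dirichlet boundary. -/
theorem partitionFunction_eq_det {G : SimpleGraph W} (r : W) (Φ : Connection G) :
    (partitionFunction r Φ : ℂ) = (lap Φ (Finset.univ.erase r)).det := by
  classical
  rw [det_lap_eq_sum_outMaps, ← Finset.sum_fiberwise _ followGraph, partitionFunction,
    totalWeight, Complex.ofReal_sum, Finset.sum_filter]
  refine Finset.sum_congr rfl fun Γ _ => ?_
  by_cases hess : IsEssential G r Γ
  · rw [if_pos ⟨hess, Set.mem_univ _⟩, ← sum_fiber_eq_weight Φ hess]
  · rw [if_neg fun h => hess h.1]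
    symm
    refine Finset.sum_eq_zero fun f hf => ?_
    rw [Finset.mem_filter] at hf
    by_contra hne
    apply hess
    rw [← hf.2]
    refine isEssential_followGraph hf.1 fun σ hσ => ?_
    by_contra h3
    exact hne (Finset.prod_eq_zero hσ (one_sub_monodromy_eq_zero Φ hf.1 hσ h3))

end CRSF

/-! ### Reduction to an upper bound for the partition function -/

namespace CRSF

open Equiv

variable {W : Type*} [Fintype W] [DecidableEq W]

theorem cycleWeight_nonneg {G : SimpleGraph W} (Φ : Connection G) (z : Sym2 (Perm W)) :
    0 ≤ cycleWeight Φ z := by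
  induction z with
  | h σ τ =>
    simp only [cycleWeight, Sym2.lift_mk]
    have h (c : Circle) : (c : ℂ).re ≤ 1 :=
      (Complex.re_le_norm _).trans (Circle.norm_coe c).le
    linarith [h (monodromy Φ σ), h (monodromy Φ τ)]

theorem cycleWeight_trivial (G : SimpleGraph W) (z : Sym2 (Perm W)) :
    cycleWeight (Connection.trivial G) z = 0 := by
  induction z with
  | h σ τ =>
    simp only [cycleWeight, Sym2.lift_mk, monodromy, Connection.trivial, Finset.prod_const_one]
    norm_num

theorem weight_nonneg {G : SimpleGraph W} (Φ : Connection G) (Γ : SimpleGraph W) :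
    0 ≤ weight Φ Γ := Finset.prod_nonneg fun z _ => cycleWeight_nonneg Φ z

/-- Every cycle has weight 0 for the trivial connection, and a forest without cycles has weight 1
for any connection. -/
theorem partitionFunction_trivial_eq {G : SimpleGraph W} (r : W) (Φ : Connection G) :
    partitionFunction r (Connection.trivial G) = totalWeight r Φ {Γ | cycles Γ = ∅} := by
  classical
  rw [partitionFunction, totalWeight, totalWeight]
  symm
  refine Finset.sum_subset_zero_on_sdiff (fun Γ h => ?_) (fun Γ h => ?_) (fun Γ h => ?_)
  · simp only [Finset.mem_filter, Finset.mem_univ, true_and, Set.mem_univ, and_true] at h ⊢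
    exact h.1
  · simp only [Finset.mem_sdiff, Finset.mem_filter, Finset.mem_univ, true_and, Set.mem_univ,
      and_true, Set.mem_ofPred_eq, not_and] at h
    obtain ⟨z, hz⟩ := Finset.nonempty_iff_ne_empty.mpr (h.2 h.1)
    exact Finset.prod_eq_zero hz (cycleWeight_trivial G z)
  · simp only [Finset.mem_filter, Finset.mem_univ, true_and, Set.mem_ofPred_eq] at h
    simp [weight, h.2]

theorem partitionFunction_trivial_le {G : SimpleGraph W} (r : W) (Φ : Connection G) :
    partitionFunction r (Connection.trivial G) ≤ partitionFunction r Φ := by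
  classical
  rw [partitionFunction_trivial_eq r Φ, partitionFunction, totalWeight, totalWeight]
  refine Finset.sum_le_sum_of_subset_of_nonneg (fun Γ h => ?_) fun Γ _ _ => weight_nonneg Φ Γ
  simp only [Finset.mem_filter, Finset.mem_univ, true_and, Set.mem_univ, and_true] at h ⊢
  exact h.1

/-- The probability of no cycle is Z_I / Z_Φ ≥ 1 / (1 + δ) ≥ 1 - δ, and the ratio is at least 1 by
nonnegativity of the weights. -/
theorem ratio_and_prob_of_le {G : SimpleGraph W} (r : W) (Φ : Connection G) {δ : ℝ}
    (hpos : 0 < partitionFunction r (Connection.trivial G))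
    (hle : partitionFunction r Φ ≤ (1 + δ) * partitionFunction r (Connection.trivial G)) :
    0 < partitionFunction r Φ ∧
      |partitionFunction r Φ / partitionFunction r (Connection.trivial G) - 1| ≤ δ ∧
      1 - δ ≤ prob r Φ {Γ | cycles Γ = ∅} := by
  have h1 := partitionFunction_trivial_le r Φ
  have hp := hpos.trans_le h1
  rw [prob, ← partitionFunction_trivial_eq r Φ]
  set a := partitionFunction r (Connection.trivial G)
  set b := partitionFunction r Φ
  refine ⟨hp, ?_, ?_⟩
  · have e : b / a - 1 = (b - a) / a := by field_simp
    rw [e, abs_of_nonneg (div_nonneg (by linarith) hpos.le), div_le_iff₀ hpos]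
    linarith
  · rw [le_div_iff₀ hp]
    have hδ : 0 ≤ δ := by
      by_contra hneg
      nlinarith
    nlinarith

/-! ### Dirichlet energy, elimination of a vertex, change of gauge -/

open Classical in
/-- The Laplacian of a connection, as an operator on functions. -/
noncomputable def lapOp {G : SimpleGraph W} (Φ : Connection G) (h : W → ℂ) (u : W) : ℂ :=
  ∑ w, if G.Adj u w then h u - Φ.transport u w * h w else 0

open Classical in
/-- The Dirichlet energy of a function with respect to a connection. -/
noncomputable def energy {G : SimpleGraph W} (Φ : Connection G) (h : W → ℂ) : ℝ :=
  (∑ u, ∑ w, if G.Adj u w then ‖h u - Φ.transport u w * h w‖ ^ 2 else 0) / 2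

open Classical in
theorem lap_mulVec {G : SimpleGraph W} (Φ : Connection G) (S : Finset W) (h : W → ℂ) (u : W) :
    (lap Φ S).mulVec h u = if u ∈ S then lapOp Φ h u else h u := by
  simp only [Matrix.mulVec, dotProduct, lap, lapOp]
  split_ifs with hu
  · have e : ∀ w, (if u = w then (G.degree u : ℂ) else
        if G.Adj u w then -(Φ.transport u w : ℂ) else 0) * h w =
        (if u = w then (G.degree u : ℂ) * h w else 0) -
          (if G.Adj u w then (Φ.transport u w : ℂ) * h w else 0) := by
      intro w
      by_cases huw : u = w
      · subst huw; simp
      · simp only [huw, if_false]; split_ifs <;> simp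
    have e' : ∀ w, (if G.Adj u w then h u - (Φ.transport u w : ℂ) * h w else 0) =
        (if G.Adj u w then h u else 0) -
          (if G.Adj u w then (Φ.transport u w : ℂ) * h w else 0) := by
      intro w; split_ifs <;> simp
    simp_rw [e, e', Finset.sum_sub_distrib]
    congr 1
    rw [Finset.sum_ite_eq, if_pos (Finset.mem_univ u), ← Finset.sum_filter, Finset.sum_const,
      nsmul_eq_mul, ← G.neighborFinset_eq_filter, SimpleGraph.card_neighborFinset_eq_degree]
  · simp

open Classical in
theorem sum_conj_mul_lapOp {G : SimpleGraph W} (Φ : Connection G) (k h : W → ℂ) :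
    ∑ u, (starRingEnd ℂ) (k u) * lapOp Φ h u =
      (∑ u, ∑ w, if G.Adj u w then (starRingEnd ℂ) (k u - Φ.transport u w * k w) *
        (h u - Φ.transport u w * h w) else 0) / 2 := by
  have h1 : ∑ u, (starRingEnd ℂ) (k u) * lapOp Φ h u =
      ∑ u, ∑ w, if G.Adj u w then (starRingEnd ℂ) (k u) * (h u - Φ.transport u w * h w)
        else 0 := by
    refine Finset.sum_congr rfl fun u _ => ?_
    rw [lapOp, Finset.mul_sum]
    refine Finset.sum_congr rfl fun w _ => ?_
    split_ifs <;> simp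
  -- The same sum with each edge read from its other end; averaging the two readings is summation by
  -- parts.
  have h2 : ∑ u, (starRingEnd ℂ) (k u) * lapOp Φ h u =
      ∑ u, ∑ w, if G.Adj u w then
        -((starRingEnd ℂ) (Φ.transport u w * k w) * (h u - Φ.transport u w * h w)) else 0 := by
    rw [h1, Finset.sum_comm]
    refine Finset.sum_congr rfl fun w _ => Finset.sum_congr rfl fun u _ => ?_
    by_cases hadj : G.Adj u w
    · rw [if_pos hadj, if_pos hadj.symm, Φ.transport_symm u w hadj, Circle.coe_inv_eq_conj]
      have hn : (starRingEnd ℂ) (Φ.transport u w : ℂ) * (Φ.transport u w : ℂ) = 1 := by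
        rw [mul_comm, Complex.mul_conj, Circle.normSq_coe]; simp
      simp only [map_mul, Complex.conj_conj]
      linear_combination -(starRingEnd ℂ) (k u) * h u * hn
    · rw [if_neg hadj, if_neg fun h' => hadj h'.symm]
  have h3 : ∑ u, (starRingEnd ℂ) (k u) * lapOp Φ h u =
      (∑ u, (starRingEnd ℂ) (k u) * lapOp Φ h u + ∑ u, (starRingEnd ℂ) (k u) * lapOp Φ h u) / 2 := by
    ring
  rw [h3]
  nth_rewrite 1 [h1]
  rw [h2, ← Finset.sum_add_distrib]
  congr 1
  refine Finset.sum_congr rfl fun u _ => ?_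
  rw [← Finset.sum_add_distrib]
  refine Finset.sum_congr rfl fun w _ => ?_
  split_ifs
  · rw [map_sub]; ring
  · simp

theorem energy_nonneg {G : SimpleGraph W} (Φ : Connection G) (h : W → ℂ) : 0 ≤ energy Φ h := by
  classical
  refine div_nonneg (Finset.sum_nonneg fun u _ => Finset.sum_nonneg fun w _ => ?_) (by norm_num)
  split_ifs <;> positivity

theorem sum_conj_mul_lapOp_self {G : SimpleGraph W} (Φ : Connection G) (h : W → ℂ) :
    ∑ u, (starRingEnd ℂ) (h u) * lapOp Φ h u = (energy Φ h : ℂ) := by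
  classical
  rw [sum_conj_mul_lapOp, energy]
  push_cast
  congr 1
  refine Finset.sum_congr rfl fun u _ => Finset.sum_congr rfl fun w _ => ?_
  split_ifs
  · rw [Complex.conj_mul', Complex.ofReal_pow]
  · simp

theorem energy_add {G : SimpleGraph W} (Φ : Connection G) (h d : W → ℂ) :
    energy Φ (h + d) = energy Φ h + energy Φ d +
      2 * (∑ u, (starRingEnd ℂ) (d u) * lapOp Φ h u).re := by
  classical
  rw [sum_conj_mul_lapOp]
  have e : ∀ z : ℂ, 2 * (z / 2).re = z.re := by
    intro z
    rw [show z / 2 = z / ((2 : ℝ) : ℂ) by norm_num, Complex.div_ofReal_re]; ring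
  rw [e, Complex.re_sum]
  simp_rw [Complex.re_sum, energy]
  rw [← add_div, ← Finset.sum_add_distrib]
  rw [div_add' _ _ _ (two_ne_zero), Finset.sum_mul, ← Finset.sum_add_distrib]
  congr 1
  refine Finset.sum_congr rfl fun u _ => ?_
  rw [Finset.sum_mul, ← Finset.sum_add_distrib, ← Finset.sum_add_distrib]
  refine Finset.sum_congr rfl fun w _ => ?_
  split_ifs
  · simp only [Pi.add_apply]
    generalize hA : h u - (Φ.transport u w : ℂ) * h w = A
    generalize hB : d u - (Φ.transport u w : ℂ) * d w = B
    have : h u + d u - (Φ.transport u w : ℂ) * (h w + d w) = A + B := by rw [← hA, ← hB]; ring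
    rw [this, ← Complex.normSq_eq_norm_sq, ← Complex.normSq_eq_norm_sq,
      ← Complex.normSq_eq_norm_sq]
    simp only [Complex.normSq_apply, Complex.add_re, Complex.add_im, Complex.mul_re,
      Complex.conj_re, Complex.conj_im]
    ring
  · simp

/-- Zero energy means that h is parallel along every edge, hence of constant modulus on a connected
graph. -/
theorem eq_zero_of_energy_eq_zero {G : SimpleGraph W} (hG : G.Preconnected) (Φ : Connection G)
    {h : W → ℂ} {r : W} (hr : h r = 0) (h0 : energy Φ h = 0) (v : W) : h v = 0 := by
  classical
  have hsum : ∑ u, ∑ w, (if G.Adj u w then ‖h u - Φ.transport u w * h w‖ ^ 2 else 0) = 0 := by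
    rw [energy] at h0; linarith
  have hnn : ∀ u w, 0 ≤ (if G.Adj u w then ‖h u - Φ.transport u w * h w‖ ^ 2 else 0) := by
    intro u w; split_ifs <;> positivity
  have hadj : ∀ u w, G.Adj u w → ‖h u‖ = ‖h w‖ := by
    intro u w huw
    have h1 := (Finset.sum_eq_zero_iff_of_nonneg
      (fun u _ => Finset.sum_nonneg fun w _ => hnn u w)).mp hsum u (Finset.mem_univ u)
    have h2 := (Finset.sum_eq_zero_iff_of_nonneg fun w _ => hnn u w).mp h1 w (Finset.mem_univ w)
    rw [if_pos huw] at h2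
    have h3 : h u = Φ.transport u w * h w := by
      rw [← sub_eq_zero, ← norm_eq_zero]
      exact pow_eq_zero_iff two_ne_zero |>.mp h2
    rw [h3, norm_mul, Circle.norm_coe, one_mul]
  obtain ⟨p⟩ := hG v r
  have : ‖h v‖ = ‖h r‖ := by
    clear hr
    induction p with
    | nil => rfl
    | cons hd q ih => rw [hadj _ _ hd, ih]
  rw [← norm_eq_zero, this, hr, norm_zero]

/-- The Laplacian on the enlarged domain sends h to a multiple of the unit vector at v. Cramer's
rule at v then gives the ratio of determinants, the cofactor being the determinant on the smaller
domain. -/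
theorem det_lap_insert {G : SimpleGraph W} (Φ : Connection G) {S : Finset W} {v : W} (hv : v ∉ S)
    {h : W → ℂ} (h1 : h v = 1) (h0 : ∀ u, u ∉ insert v S → h u = 0)
    (hharm : ∀ u ∈ S, lapOp Φ h u = 0) :
    (lap Φ (insert v S)).det = lapOp Φ h v * (lap Φ S).det := by
  classical
  have hvec : (lap Φ (insert v S)).mulVec h = Pi.single v (lapOp Φ h v) := by
    funext u
    rw [lap_mulVec]
    by_cases huv : u = v
    · subst huv; simp
    · rw [Pi.single_eq_of_ne huv]
      split_ifs with hu
      · exact hharm u (Finset.mem_of_mem_insert_of_ne hu huv)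
      · exact h0 u hu
  have hrow : (lap Φ (insert v S)).adjugate v v = (lap Φ S).det := by
    rw [Matrix.adjugate_apply]
    congr 1
    ext u w
    by_cases huv : u = v
    · subst huv
      simp [lap, hv, Pi.single_apply, eq_comm]
    · simp [lap, huv]
  have key := congrFun (congrArg (fun A => Matrix.mulVec A h)
    (Matrix.adjugate_mul (lap Φ (insert v S)))) v
  simp only [← Matrix.mulVec_mulVec, hvec, Matrix.smul_mulVec, Matrix.one_mulVec, Pi.smul_apply,
    h1, smul_eq_mul, mul_one] at key
  rw [← key, Matrix.mulVec_single, ← hrow]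
  simp [mul_comm]

/-- The solution is column v of the inverse of `lap Φ S`: the identity rows outside S impose the
boundary values. -/
theorem exists_harmonic {G : SimpleGraph W} (Φ : Connection G) {S : Finset W} {v : W}
    (hv : v ∉ S) (hdet : (lap Φ S).det ≠ 0) :
    ∃ h : W → ℂ, h v = 1 ∧ (∀ u, u ∉ insert v S → h u = 0) ∧ ∀ u ∈ S, lapOp Φ h u = 0 := by
  classical
  refine ⟨(lap Φ S)⁻¹.mulVec (Pi.single v 1), ?_⟩
  have key : (lap Φ S).mulVec ((lap Φ S)⁻¹.mulVec (Pi.single v 1)) = Pi.single v 1 := by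
    rw [Matrix.mulVec_mulVec, Matrix.mul_nonsing_inv _ (isUnit_iff_ne_zero.mpr hdet),
      Matrix.one_mulVec]
  set h := (lap Φ S)⁻¹.mulVec (Pi.single v 1)
  have hk : ∀ u, (if u ∈ S then lapOp Φ h u else h u) = (Pi.single v 1 : W → ℂ) u := fun u => by
    rw [← lap_mulVec, key]
  refine ⟨?_, fun u hu => ?_, fun u hu => ?_⟩
  · have := hk v
    rwa [if_neg hv, Pi.single_eq_same] at this
  · rw [Finset.mem_insert, not_or] at hu
    have := hk u
    rwa [if_neg hu.2, Pi.single_eq_of_ne hu.1] at this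
  · have := hk u
    rwa [if_pos hu, Pi.single_eq_of_ne (by rintro rfl; exact hv hu)] at this

/-- In the pairing of h with its Laplacian only the term at v survives. -/
theorem lapOp_eq_energy {G : SimpleGraph W} (Φ : Connection G) {S : Finset W} {v : W}
    {h : W → ℂ} (h1 : h v = 1) (h0 : ∀ u, u ∉ insert v S → h u = 0)
    (hharm : ∀ u ∈ S, lapOp Φ h u = 0) : lapOp Φ h v = (energy Φ h : ℂ) := by
  rw [← sum_conj_mul_lapOp_self, Finset.sum_eq_single v]
  · simp [h1]
  · intro u _ huv
    by_cases hu : u ∈ S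
    · rw [hharm u hu, mul_zero]
    · rw [h0 u (by simp [huv, hu])]; simp
  · simp

/-- Dirichlet's principle: k - h vanishes wherever the Laplacian of h need not, so the cross term in
the energy is zero. -/
theorem energy_le_of_harmonic {G : SimpleGraph W} (Φ : Connection G) {S : Finset W} {v : W}
    {h k : W → ℂ} (h0 : ∀ u, u ∉ insert v S → h u = 0)
    (hharm : ∀ u ∈ S, lapOp Φ h u = 0) (hkv : k v = h v) (k0 : ∀ u, u ∉ insert v S → k u = 0) :
    energy Φ h ≤ energy Φ k := by
  have e : k = h + (k - h) := by abel
  rw [e, energy_add, Finset.sum_eq_zero]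
  · simpa using energy_nonneg Φ (k - h)
  · intro u _
    by_cases huv : u = v
    · subst huv; simp [hkv]
    · by_cases hu : u ∈ S
      · rw [hharm u hu, mul_zero]
      · have : u ∉ insert v S := by simp [huv, hu]
        simp [h0 u this, k0 u this]

open Classical in
/-- The Laplacian on real functions. -/
noncomputable def realLap (G : SimpleGraph W) (h : W → ℝ) (u : W) : ℝ :=
  ∑ w, if G.Adj u w then h u - h w else 0

theorem lapOp_trivial {G : SimpleGraph W} (h : W → ℝ) (u : W) :
    lapOp (Connection.trivial G) (fun u => (h u : ℂ)) u = (realLap G h u : ℂ) := by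
  classical
  rw [lapOp, realLap, Complex.ofReal_sum]
  refine Finset.sum_congr rfl fun w _ => ?_
  split_ifs <;> simp [Connection.trivial]

theorem re_lapOp_trivial {G : SimpleGraph W} (h : W → ℂ) (u : W) :
    (lapOp (Connection.trivial G) h u).re = realLap G (fun u => (h u).re) u := by
  classical
  rw [lapOp, realLap, Complex.re_sum]
  refine Finset.sum_congr rfl fun w _ => ?_
  split_ifs <;> simp [Connection.trivial]

/-- One step of the elimination: comparing the Dirichlet determinants of a connection and of the
trivial connection when a vertex is added to the domain. -/
theorem det_lap_insert_le {G : SimpleGraph W} (hG : G.Preconnected) (Φ : Connection G) {r v : W}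
    {S : Finset W} (hv : v ∉ S) (hvr : v ≠ r) (hr : r ∉ S) {a b M ε : ℝ} (ha : 0 < a)
    (hb : 0 < b) (hda : (lap Φ S).det = a) (hdb : (lap (Connection.trivial G) S).det = b)
    (hab : a ≤ M * b)
    (htest : ∀ h : W → ℝ, h v = 1 → (∀ u, u ∉ insert v S → h u = 0) →
      (∀ u ∈ S, realLap G h u = 0) → ∃ k : W → ℂ, k v = 1 ∧ (∀ u, u ∉ insert v S → k u = 0) ∧
        energy Φ k ≤ (1 + ε) * energy (Connection.trivial G) (fun u => (h u : ℂ))) :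
    ∃ a' b' : ℝ, 0 < a' ∧ 0 < b' ∧ (lap Φ (insert v S)).det = a' ∧
      (lap (Connection.trivial G) (insert v S)).det = b' ∧ a' ≤ (1 + ε) * M * b' := by
  have hrT : r ∉ insert v S := by simp [hr, hvr.symm]
  obtain ⟨hc, hc1, hc0, hch⟩ := exists_harmonic (Connection.trivial G) hv
    (by rw [hdb]; exact_mod_cast hb.ne')
  obtain ⟨g, g1, g0, gh⟩ := exists_harmonic Φ hv (by rw [hda]; exact_mod_cast ha.ne')
  -- The trivial Laplacian has real coefficients, so the real part is again a solution with the same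
  -- boundary values; the maximum principle needs a real function.
  set h : W → ℝ := fun u => (hc u).re with hh
  have h1 : h v = 1 := by simp [hh, hc1]
  have h0 : ∀ u, u ∉ insert v S → h u = 0 := fun u hu => by simp [hh, hc0 u hu]
  have hharm : ∀ u ∈ S, realLap G h u = 0 := fun u hu => by
    rw [hh, ← re_lapOp_trivial, hch u hu, Complex.zero_re]
  have h1' : ((h v : ℝ) : ℂ) = 1 := by rw [h1]; simp
  have h0' : ∀ u, u ∉ insert v S → ((h u : ℝ) : ℂ) = 0 := fun u hu => by rw [h0 u hu]; simp
  have hharm' : ∀ u ∈ S, lapOp (Connection.trivial G) (fun u => (h u : ℂ)) u = 0 :=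
    fun u hu => by rw [lapOp_trivial, hharm u hu]; simp
  obtain ⟨k, k1, k0, hk⟩ := htest h h1 h0 hharm
  have hle := (energy_le_of_harmonic Φ g0 gh (k1.trans g1.symm) k0).trans hk
  have hpos : ∀ (Ψ : Connection G) (f : W → ℂ), f v = 1 → (∀ u, u ∉ insert v S → f u = 0) →
      0 < energy Ψ f := by
    intro Ψ f f1 f0
    refine (energy_nonneg Ψ f).lt_of_ne' fun he => ?_
    have := eq_zero_of_energy_eq_zero hG Ψ (f0 r hrT) he v
    rw [f1] at this
    exact one_ne_zero this
  have p1 := hpos Φ g g1 g0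
  have p2 := hpos (Connection.trivial G) _ h1' h0'
  refine ⟨energy Φ g * a, energy (Connection.trivial G) (fun u => (h u : ℂ)) * b,
    mul_pos p1 ha, mul_pos p2 hb, ?_, ?_, ?_⟩
  · rw [det_lap_insert Φ hv g1 g0 gh, lapOp_eq_energy Φ g1 g0 gh, hda]; push_cast; ring
  · rw [det_lap_insert (h := fun u => (h u : ℂ)) _ hv h1' h0' hharm', lapOp_eq_energy (h := fun u => (h u : ℂ)) _ h1' h0' hharm', hdb]
    push_cast; ring
  · calc energy Φ g * a ≤ ((1 + ε) * energy (Connection.trivial G) (fun u => (h u : ℂ))) *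
          (M * b) := mul_le_mul hle hab ha.le (p1.le.trans hle)
      _ = _ := by ring

-- On each edge, |a - ψ b|² - (a - b)² = 2 (1 - Re ψ) a b for real a, b and |ψ| = 1; only the
-- gauge-transformed transport ψ matters.
open Classical in
theorem energy_gauge {G : SimpleGraph W} (Φ : Connection G) (l : W → Circle) (h : W → ℝ) :
    energy Φ (fun u => (l u : ℂ) * (h u : ℂ)) =
      energy (Connection.trivial G) (fun u => (h u : ℂ)) +
      ∑ u, ∑ w, if G.Adj u w then
        (1 - (((l u)⁻¹ * Φ.transport u w * l w : Circle) : ℂ).re) * (h u * h w) else 0 := by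
  rw [energy, energy, div_add' _ _ _ two_ne_zero, Finset.sum_mul, ← Finset.sum_add_distrib]
  congr 1
  refine Finset.sum_congr rfl fun u _ => ?_
  rw [Finset.sum_mul, ← Finset.sum_add_distrib]
  refine Finset.sum_congr rfl fun w _ => ?_
  split_ifs
  · set ψ : Circle := (l u)⁻¹ * Φ.transport u w * l w with hψ
    have e : (l u : ℂ) * (h u : ℂ) - (Φ.transport u w : ℂ) * ((l w : ℂ) * (h w : ℂ)) =
        (l u : ℂ) * ((h u : ℂ) - (ψ : ℂ) * (h w : ℂ)) := by
      have : (l u : ℂ) * (ψ : ℂ) = Φ.transport u w * l w := by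
        rw [← Circle.coe_mul, ← Circle.coe_mul, hψ]
        congr 1
        rw [mul_assoc, mul_inv_cancel_left]
      linear_combination (h w : ℂ) * this
    rw [e, norm_mul, Circle.norm_coe, one_mul]
    have hn := Circle.normSq_coe ψ
    rw [Complex.normSq_apply] at hn
    simp only [Connection.trivial, Circle.coe_one, one_mul]
    rw [← Complex.normSq_eq_norm_sq, ← Complex.normSq_eq_norm_sq]
    simp only [Complex.normSq_apply, Complex.sub_re, Complex.sub_im, Complex.mul_re,
      Complex.mul_im, Complex.ofReal_re, Complex.ofReal_im]
    linear_combination (h w) ^ 2 * hn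
  · simp

end CRSF

/-! ### One-dimensional massive profiles -/

namespace CylinderGreen

/-- The solution of `u (j + 2) = (2 + l) * u (j + 1) - u j` with `u 0 = 0` and `u 1 = 1`. -/
noncomputable def sinhSeq (l : ℝ) : ℕ → ℝ
  | 0 => 0
  | 1 => 1
  | (j + 2) => (2 + l) * sinhSeq l (j + 1) - sinhSeq l j

/-- The solution of the one-dimensional massive Dirichlet problem on `{0, …, M}` with boundary
values `0` and `1`. -/
noncomputable def profile (l : ℝ) (M j : ℕ) : ℝ := sinhSeq l j / sinhSeq l M

/-- With mass l = s², the sequence grows by a factor at least 1 + s per step. The induction closes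
because (1 + s² - s)(1 + s) = 1 + s³ ≥ 1. -/
theorem sinhSeq_step {s : ℝ} (hs : 0 ≤ s) (j : ℕ) :
    0 ≤ sinhSeq (s ^ 2) j ∧ 0 < sinhSeq (s ^ 2) (j + 1) ∧
      (1 + s) * sinhSeq (s ^ 2) j ≤ sinhSeq (s ^ 2) (j + 1) := by
  induction j with
  | zero => simp [sinhSeq]
  | succ j ih =>
    obtain ⟨h1, h2, h3⟩ := ih
    have e : sinhSeq (s ^ 2) (j + 1 + 1) =
      (2 + s ^ 2) * sinhSeq (s ^ 2) (j + 1) - sinhSeq (s ^ 2) j := rfl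
    have key : (1 + s) * sinhSeq (s ^ 2) (j + 1) ≤ sinhSeq (s ^ 2) (j + 1 + 1) := by
      rw [e]
      have hq : 0 ≤ 1 + s ^ 2 - s := by nlinarith [sq_nonneg (s - 1)]
      have h4 := mul_le_mul_of_nonneg_left h3 hq
      have h5 : 0 ≤ s ^ 3 * sinhSeq (s ^ 2) j := by positivity
      nlinarith
    refine ⟨h2.le, lt_of_lt_of_le ?_ key, key⟩
    positivity

theorem sinhSeq_pow_le {s : ℝ} (hs : 0 ≤ s) (j i : ℕ) :
    (1 + s) ^ i * sinhSeq (s ^ 2) j ≤ sinhSeq (s ^ 2) (j + i) := by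
  induction i with
  | zero => simp
  | succ i ih =>
    have h := (sinhSeq_step hs (j + i)).2.2
    have h2 := mul_le_mul_of_nonneg_left ih (by linarith : 0 ≤ 1 + s)
    rw [pow_succ']
    calc _ = (1 + s) * ((1 + s) ^ i * sinhSeq (s ^ 2) j) := by ring
      _ ≤ _ := h2.trans h

theorem sinhSeq_pos {l : ℝ} (hl : 0 ≤ l) {M : ℕ} (hM : 0 < M) : 0 < sinhSeq l M := by
  obtain ⟨m, rfl⟩ : ∃ m, M = m + 1 := ⟨M - 1, by omega⟩
  have := (sinhSeq_step (Real.sqrt_nonneg l) m).2.1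
  rwa [Real.sq_sqrt hl] at this

theorem profile_nonneg {l : ℝ} (hl : 0 ≤ l) {M : ℕ} (hM : 0 < M) (j : ℕ) :
    0 ≤ profile l M j := by
  refine div_nonneg ?_ (sinhSeq_pos hl hM).le
  have := (sinhSeq_step (Real.sqrt_nonneg l) j).1
  rwa [Real.sq_sqrt hl] at this

theorem profile_zero (l : ℝ) (M : ℕ) : profile l M 0 = 0 := by simp [profile, sinhSeq]

theorem profile_self {l : ℝ} (hl : 0 ≤ l) {M : ℕ} (hM : 0 < M) : profile l M M = 1 :=
  div_self (sinhSeq_pos hl hM).ne'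

theorem profile_recurrence (l : ℝ) (M j : ℕ) :
    (2 + l) * profile l M (j + 1) = profile l M (j + 2) + profile l M j := by
  simp only [profile, sinhSeq]
  ring

/-- Geometric growth weakened by Bernoulli's inequality; linear decay away from the end M is all
that the ℓ² bounds use. -/
theorem one_add_mul_profile_le {s : ℝ} (hs : 0 ≤ s) {M j : ℕ} (hM : 0 < M) (hj : j ≤ M) :
    (1 + ((M - j : ℕ) : ℝ) * s) * profile (s ^ 2) M j ≤ 1 := by
  have h1 := sinhSeq_pow_le hs j (M - j)
  rw [Nat.add_sub_cancel' hj] at h1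
  have hpos := sinhSeq_pos (sq_nonneg s) hM
  have h2 : 1 + ((M - j : ℕ) : ℝ) * s ≤ (1 + s) ^ (M - j) := one_add_mul_le_pow (by linarith) _
  rw [profile, ← mul_div_assoc, div_le_one hpos]
  exact (mul_le_mul_of_nonneg_right h2 (sinhSeq_step hs j).1).trans h1

theorem profile_le_one {l : ℝ} (hl : 0 ≤ l) {M j : ℕ} (hM : 0 < M) (hj : j ≤ M) :
    profile l M j ≤ 1 := by
  have h := one_add_mul_profile_le (Real.sqrt_nonneg l) hM hj
  rw [Real.sq_sqrt hl] at h
  have h0 := profile_nonneg hl hM j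
  have : 0 ≤ ((M - j : ℕ) : ℝ) * Real.sqrt l * profile l M j := by positivity
  linarith

theorem sq_mul_sq_profile_le {l : ℝ} (hl : 0 < l) {M j : ℕ} (hM : 0 < M) (hj : j ≤ M) :
    ((M - j : ℕ) : ℝ) ^ 2 * profile l M j ^ 2 ≤ 1 / l := by
  have h := one_add_mul_profile_le (Real.sqrt_nonneg l) hM hj
  rw [Real.sq_sqrt hl.le] at h
  have h0 := profile_nonneg hl.le hM j
  have h1 : 0 ≤ ((M - j : ℕ) : ℝ) * Real.sqrt l * profile l M j := by positivity
  have h2 : ((M - j : ℕ) : ℝ) * Real.sqrt l * profile l M j ≤ 1 := by linarith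
  rw [le_div_iff₀ hl]
  calc _ = (((M - j : ℕ) : ℝ) * Real.sqrt l * profile l M j) ^ 2 := by
        rw [mul_pow, mul_pow, Real.sq_sqrt hl.le]; ring
    _ ≤ 1 := pow_le_one₀ h1 h2

/-- Maximum principle in one variable: at an interior maximum of the difference D, the two
recurrences give l · D ≤ (l' - l) · `profile l' M`, and the profile lies in [0, 1]. -/
theorem profile_sub_le {l l' : ℝ} (hl : 0 < l) (hl' : 0 < l') {M j : ℕ} (hM : 0 < M)
    (hj : j ≤ M) : profile l M j - profile l' M j ≤ |l - l'| / l := by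
  obtain ⟨i, hi, hmax⟩ := Finset.exists_max_image (Finset.range (M + 1))
    (fun j => profile l M j - profile l' M j) ⟨0, by simp⟩
  rw [Finset.mem_range] at hi
  refine (hmax j (Finset.mem_range.mpr (by omega))).trans ?_
  have hnn : 0 ≤ |l - l'| / l := by positivity
  rcases Nat.eq_zero_or_pos i with rfl | hi0
  · simpa [profile_zero] using hnn
  rcases (Nat.lt_succ_iff.mp hi).eq_or_lt with rfl | hiM
  · simpa [profile_self hl.le hM, profile_self hl'.le hM] using hnn
  obtain ⟨k, rfl⟩ : ∃ k, i = k + 1 := ⟨i - 1, by omega⟩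
  have h1 := hmax k (Finset.mem_range.mpr (by omega))
  have h2 := hmax (k + 2) (Finset.mem_range.mpr (by omega))
  have r1 := profile_recurrence l M k
  have r2 := profile_recurrence l' M k
  have p1 := profile_le_one hl'.le hM hiM.le
  have p0 := profile_nonneg hl'.le hM (k + 1)
  have h3 : (l' - l) * profile l' M (k + 1) ≤ |l - l'| := by
    have : (l' - l) ≤ |l - l'| := by rw [abs_sub_comm]; exact le_abs_self _
    nlinarith [abs_nonneg (l - l')]
  rw [le_div_iff₀ hl]
  nlinarith

theorem sq_profile_sub_le {l l' : ℝ} (hl : 0 < l) (hl' : 0 < l') {M j : ℕ} (hM : 0 < M)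
    (hj : j ≤ M) : (profile l M j - profile l' M j) ^ 2 ≤
      (l - l') ^ 2 / l ^ 2 + (l - l') ^ 2 / l' ^ 2 := by
  have h1 := profile_sub_le hl hl' hM hj
  have h2 := profile_sub_le hl' hl hM hj
  have n1 : 0 ≤ (l - l') ^ 2 / l ^ 2 := by positivity
  have n2 : 0 ≤ (l - l') ^ 2 / l' ^ 2 := by positivity
  rcases le_total 0 (profile l M j - profile l' M j) with h | h
  · have := pow_le_pow_left₀ h h1 2
    rw [div_pow, sq_abs] at this
    linarith
  · have := pow_le_pow_left₀ (by linarith : 0 ≤ profile l' M j - profile l M j) h2 2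
    rw [div_pow, sq_abs, ← neg_sub l l', neg_sq, ← neg_sub (profile l M j), neg_sq] at this
    linarith

/-! ### Frequencies on the discrete circle -/

variable {n : ℕ} [NeZero n]

/-- The distance from `1` of the `k`-th power of the standard primitive root of unity. -/
noncomputable def freq (k : ZMod n) : ℝ := ‖(ZMod.stdAddChar k : ℂ) - 1‖

theorem freq_nonneg (k : ZMod n) : 0 ≤ freq k := norm_nonneg _

theorem norm_stdAddChar (k : ZMod n) : ‖(ZMod.stdAddChar k : ℂ)‖ = 1 := AddChar.norm_apply _ k

theorem freq_sq (k : ZMod n) : freq k ^ 2 = 2 - 2 * (ZMod.stdAddChar k : ℂ).re := by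
  have h := norm_stdAddChar k
  rw [freq, ← Complex.normSq_eq_norm_sq, Complex.normSq_apply]
  have h2 : (ZMod.stdAddChar k : ℂ).re * (ZMod.stdAddChar k : ℂ).re +
      (ZMod.stdAddChar k : ℂ).im * (ZMod.stdAddChar k : ℂ).im = 1 := by
    rw [← Complex.normSq_apply, Complex.normSq_eq_norm_sq, h]; norm_num
  simp only [Complex.sub_re, Complex.sub_im, Complex.one_re, Complex.one_im]
  linarith

theorem freq_le_two (k : ZMod n) : freq k ≤ 2 := by
  refine (norm_sub_le _ _).trans ?_
  rw [norm_stdAddChar, norm_one]; norm_num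

theorem stdAddChar_re (k : ZMod n) :
    (ZMod.stdAddChar k : ℂ).re = Real.cos (2 * Real.pi * k.val / n) := by
  rw [ZMod.stdAddChar_apply, ZMod.toCircle_apply,
    show (2 * (Real.pi : ℂ) * Complex.I * (k.val : ℂ) / (n : ℂ)) =
      ((2 * Real.pi * k.val / n : ℝ) : ℂ) * Complex.I by push_cast; ring,
    Complex.exp_ofReal_mul_I_re]

theorem freq_sq_eq_sin (k : ZMod n) : freq k ^ 2 = 4 * Real.sin (Real.pi * k.val / n) ^ 2 := by
  rw [freq_sq, stdAddChar_re, show 2 * Real.pi * k.val / n = 2 * (Real.pi * k.val / n) by ring,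
    Real.cos_two_mul, Real.cos_sq']
  ring

theorem freq_add_le (k l : ZMod n) : freq (k + l) ≤ freq k + freq l := by
  have : (ZMod.stdAddChar (k + l) : ℂ) - 1 =
      ZMod.stdAddChar l * ((ZMod.stdAddChar k : ℂ) - 1) + ((ZMod.stdAddChar l : ℂ) - 1) := by
    rw [AddChar.map_add_eq_mul]; ring
  rw [freq, this]
  refine (norm_add_le _ _).trans ?_
  rw [norm_mul, norm_stdAddChar, one_mul]
  rfl

theorem freq_neg (k : ZMod n) : freq (-k) = freq k := by
  rw [← sq_eq_sq₀ (freq_nonneg _) (freq_nonneg _), freq_sq, freq_sq, AddChar.map_neg_eq_conj,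
    Complex.conj_re]

theorem freq_one_le (hn : 2 ≤ n) : freq (1 : ZMod n) ≤ 7 / n := by
  have hn0 : (0 : ℝ) < n := by exact_mod_cast (by omega : 0 < n)
  have h : freq (1 : ZMod n) ^ 2 ≤ (7 / n) ^ 2 := by
    have hv : (1 : ZMod n).val = 1 := by
      have := ZMod.val_natCast_of_lt (n := n) (a := 1) (by omega)
      simpa using this
    rw [freq_sq_eq_sin, hv]
    have h1 : Real.sin (Real.pi * (1 : ℕ) / n) ^ 2 ≤ (Real.pi * (1 : ℕ) / n) ^ 2 := by
      rw [sq_le_sq]; exact Real.abs_sin_le_abs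
    -- The 7 in the bound is 2 · 3.5, with π ≤ 3.5.
    have h2 : Real.pi ^ 2 ≤ 12.25 := by nlinarith [Real.pi_lt_d2, Real.pi_pos]
    calc _ ≤ 4 * (Real.pi * (1 : ℕ) / n) ^ 2 := by linarith
      _ = 4 * Real.pi ^ 2 / n ^ 2 := by push_cast; ring
      _ ≤ 49 / n ^ 2 := by gcongr; linarith
      _ = _ := by ring
  exact le_of_sq_le_sq h (by positivity)

/-- Jordan's inequality sin t ≥ 2t/π, applied to freq k = 2 sin(πk/n) after reflecting k to the half
circle. -/
theorem four_mul_min_div_le_freq (k : ZMod n) :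
    4 * (min k.val (n - k.val) : ℕ) / (n : ℝ) ≤ freq k := by
  have hn0 : (0 : ℝ) < n := by exact_mod_cast Nat.pos_of_ne_zero (NeZero.ne n)
  have hk := ZMod.val_lt k
  have haux : ∀ j : ℕ, 2 * j ≤ n → 2 * (j : ℝ) / n ≤ Real.sin (Real.pi * j / n) := by
    intro j hj
    have hj' : 2 * (j : ℝ) ≤ n := by exact_mod_cast hj
    have := Real.mul_le_sin (x := Real.pi * j / n) (by positivity) (by
      rw [div_le_div_iff₀ hn0 two_pos]
      nlinarith [Real.pi_pos])
    convert this using 1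
    field_simp
  have hsin : 2 * ((min k.val (n - k.val) : ℕ) : ℝ) / n ≤ Real.sin (Real.pi * k.val / n) := by
    rcases le_total k.val (n - k.val) with h | h
    · rw [min_eq_left h]; exact haux _ (by omega)
    · rw [min_eq_right h]
      have := haux (n - k.val) (by omega)
      rw [← Real.sin_pi_sub]
      convert this using 2
      rw [Nat.cast_sub hk.le]
      field_simp
  refine le_of_sq_le_sq ?_ (freq_nonneg k)
  rw [freq_sq_eq_sin]
  have := pow_le_pow_left₀ (by positivity) hsin 2
  calc _ = 4 * (2 * ((min k.val (n - k.val) : ℕ) : ℝ) / n) ^ 2 := by ring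
    _ ≤ _ := by linarith

theorem min_val_pos {k : ZMod n} (hk : k ≠ 0) : 1 ≤ min k.val (n - k.val) := by
  have h1 := ZMod.val_lt k
  have h2 : k.val ≠ 0 := by rwa [Ne, ZMod.val_eq_zero]
  omega

theorem four_div_le_freq {k : ZMod n} (hk : k ≠ 0) : 4 / (n : ℝ) ≤ freq k := by
  refine le_trans ?_ (four_mul_min_div_le_freq k)
  have : (1 : ℝ) ≤ (min k.val (n - k.val) : ℕ) := by exact_mod_cast min_val_pos hk
  gcongr
  linarith

theorem freq_pos {k : ZMod n} (hk : k ≠ 0) : 0 < freq k := by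
  have hn0 : (0 : ℝ) < n := by exact_mod_cast Nat.pos_of_ne_zero (NeZero.ne n)
  exact lt_of_lt_of_le (by positivity) (four_div_le_freq hk)

theorem sum_inv_sq_le (N : ℕ) : ∑ j ∈ Finset.range N, 1 / ((j : ℝ) + 1) ^ 2 ≤ 2 := by
  rcases Nat.eq_zero_or_pos N with rfl | hN
  · norm_num
  obtain ⟨m, rfl⟩ : ∃ m, N = m + 1 := ⟨N - 1, by omega⟩
  have h : ∑ j ∈ Finset.range (m + 1), 1 / ((j : ℝ) + 1) ^ 2 ≤ 2 - 1 / ((m : ℝ) + 1) := by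
    induction m with
    | zero => norm_num
    | succ k ih =>
      rw [Finset.sum_range_succ]
      have h1 : 1 / (((k + 1 : ℕ) : ℝ) + 1) ^ 2 ≤ 1 / ((k : ℝ) + 1) - 1 / (((k + 1 : ℕ) : ℝ) + 1) := by
        push_cast
        rw [div_sub_div _ _ (by positivity) (by positivity),
          div_le_div_iff₀ (by positivity) (by positivity)]
        have : (0 : ℝ) ≤ k := k.cast_nonneg
        nlinarith
      linarith [ih (by omega)]
  have : 0 ≤ 1 / ((m : ℝ) + 1) := by positivity
  linarith

theorem sum_one_div_val_sq (hn : 2 ≤ n) :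
    ∑ k : ZMod n with k ≠ 0, 1 / (k.val : ℝ) ^ 2 ≤ 2 := by
  refine le_of_eq_of_le ?_ (sum_inv_sq_le (n - 1))
  refine Finset.sum_nbij' (fun k => k.val - 1) (fun j => ((j + 1 : ℕ) : ZMod n)) ?_ ?_ ?_ ?_ ?_
  · intro k _
    have := ZMod.val_lt k
    rw [Finset.mem_range]; omega
  · intro j hj
    rw [Finset.mem_range] at hj
    simp only [Finset.mem_filter, Finset.mem_univ, true_and]
    rw [Ne, ← ZMod.val_eq_zero, ZMod.val_natCast_of_lt (by omega)]
    omega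
  · intro k hk
    simp only [Finset.mem_filter, Finset.mem_univ, true_and] at hk
    have := min_val_pos hk
    rw [Nat.sub_add_cancel (by omega), ZMod.natCast_zmod_val]
  · intro j hj
    rw [Finset.mem_range] at hj
    rw [ZMod.val_natCast_of_lt (by omega)]
    omega
  · intro k hk
    simp only [Finset.mem_filter, Finset.mem_univ, true_and] at hk
    have := min_val_pos hk
    rw [Nat.cast_sub (by omega)]
    simp

/-- Frequencies grow linearly with the distance from 0, so the sum is n²/16 times two copies of a
partial sum of ∑ 1/j² ≤ 2, one for each side of the circle. -/
theorem sum_one_div_freq_sq_le (hn : 2 ≤ n) :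
    ∑ k : ZMod n with k ≠ 0, 1 / freq k ^ 2 ≤ (n : ℝ) ^ 2 / 4 := by
  have hn0 : (0 : ℝ) < n := by exact_mod_cast (by omega : 0 < n)
  have hterm : ∀ k : ZMod n, k ≠ 0 → 1 / freq k ^ 2 ≤
      (n : ℝ) ^ 2 / 16 * (1 / (k.val : ℝ) ^ 2 + 1 / ((-k).val : ℝ) ^ 2) := by
    intro k hk
    have : NeZero k := ⟨hk⟩
    have hneg : (-k).val = n - k.val := ZMod.val_neg_of_ne_zero k
    have hm := min_val_pos hk
    have h := pow_le_pow_left₀ (by positivity) (four_mul_min_div_le_freq k) 2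
    have hmpos : (0 : ℝ) < (min k.val (n - k.val) : ℕ) := by exact_mod_cast hm
    have h1 : 1 / freq k ^ 2 ≤
        (n : ℝ) ^ 2 / 16 * (1 / ((min k.val (n - k.val) : ℕ) : ℝ) ^ 2) := by
      refine (one_div_le_one_div_of_le (by positivity) h).trans_eq ?_
      field_simp
      norm_num
    refine h1.trans (mul_le_mul_of_nonneg_left ?_ (by positivity))
    rw [hneg]
    have p1 : 0 ≤ 1 / (k.val : ℝ) ^ 2 := by positivity
    have p2 : 0 ≤ 1 / ((n - k.val : ℕ) : ℝ) ^ 2 := by positivity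
    rcases min_choice k.val (n - k.val) with h2 | h2 <;> rw [h2] <;> linarith
  have hsym : ∑ k : ZMod n with k ≠ 0, 1 / ((-k).val : ℝ) ^ 2 =
      ∑ k : ZMod n with k ≠ 0, 1 / (k.val : ℝ) ^ 2 :=
    Finset.sum_nbij' (fun k => -k) (fun k => -k) (by simp) (by simp) (by simp) (by simp)
      (fun _ _ => rfl)
  have h2 := sum_one_div_val_sq (n := n) hn
  calc _ ≤ ∑ k : ZMod n with k ≠ 0,
        (n : ℝ) ^ 2 / 16 * (1 / (k.val : ℝ) ^ 2 + 1 / ((-k).val : ℝ) ^ 2) :=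
        Finset.sum_le_sum fun k hk => hterm k (Finset.mem_filter.mp hk).2
    _ ≤ (n : ℝ) ^ 2 / 16 * (2 + 2) := by
        rw [← Finset.mul_sum, Finset.sum_add_distrib, hsym]
        gcongr
    _ = _ := by ring

/-! ### Parseval's identity and weighted ℓ² bounds for the Poisson kernel -/

theorem sum_norm_sq_inverse_dft (F : ZMod n → ℝ) :
    ∑ x : ZMod n, ‖(1 / n : ℂ) * ∑ k : ZMod n, ZMod.stdAddChar (k * x) * (F k : ℂ)‖ ^ 2 =
      (1 / n : ℝ) * ∑ k, F k ^ 2 := by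
  have hn0 : (n : ℂ) ≠ 0 := by exact_mod_cast NeZero.ne n
  have h : ∀ x : ZMod n, ((‖(1 / n : ℂ) * ∑ k : ZMod n, ZMod.stdAddChar (k * x) * (F k : ℂ)‖ ^ 2 :
      ℝ) : ℂ) = (1 / n : ℂ) ^ 2 * ∑ k : ZMod n, ∑ l : ZMod n,
        ((F k : ℂ) * F l) * ZMod.stdAddChar (x * (l - k)) := by
    intro x
    push_cast
    rw [← Complex.conj_mul', map_mul, map_sum]
    have : (starRingEnd ℂ) (1 / n : ℂ) = 1 / n := by simp
    rw [this, mul_mul_mul_comm, ← pow_two, Finset.sum_mul_sum]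
    congr 1
    refine Finset.sum_congr rfl fun k _ => Finset.sum_congr rfl fun l _ => ?_
    rw [map_mul, Complex.conj_ofReal, ← AddChar.map_neg_eq_conj,
      show x * (l - k) = -(k * x) + l * x by ring, AddChar.map_add_eq_mul]
    ring
  apply Complex.ofReal_injective
  rw [Complex.ofReal_sum, Finset.sum_congr rfl fun x _ => h x, ← Finset.mul_sum,
    Finset.sum_comm]
  simp_rw [Finset.sum_comm (s := (Finset.univ : Finset (ZMod n))) (t := Finset.univ)
    (f := fun x l => _ * ZMod.stdAddChar (x * (l - _))), ← Finset.mul_sum]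
  simp_rw [AddChar.sum_mulShift _ (ZMod.isPrimitive_stdAddChar n), sub_eq_zero, ZMod.card]
  push_cast
  simp only [mul_ite, mul_zero, Finset.sum_ite_eq', Finset.mem_univ, if_true, Finset.mul_sum]
  refine Finset.sum_congr rfl fun k _ => ?_
  field_simp

/-- The harmonic function on the cylinder `ZMod n × {0, …, M}` with boundary values `0` on row `0`
and the indicator function of `0` on row `M`. -/
noncomputable def poissonC (M : ℕ) (x : ZMod n) (j : ℕ) : ℂ :=
  (1 / n : ℂ) * ∑ k : ZMod n, ZMod.stdAddChar (k * x) * (profile (freq k ^ 2) M j : ℂ)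

/-- The real part of `poissonC`. -/
noncomputable def poisson (M : ℕ) (x : ZMod n) (j : ℕ) : ℝ := (poissonC M x j).re

theorem poisson_zero (M : ℕ) (x : ZMod n) : poisson M x 0 = 0 := by
  simp [poisson, poissonC, profile_zero]

theorem poisson_self {M : ℕ} (hM : 0 < M) (x : ZMod n) :
    poisson M x M = if x = 0 then 1 else 0 := by
  have hn0 : (n : ℂ) ≠ 0 := by exact_mod_cast NeZero.ne n
  simp only [poisson, poissonC, profile_self (sq_nonneg _) hM, Complex.ofReal_one, mul_one]
  rw [AddChar.sum_mulShift x (ZMod.isPrimitive_stdAddChar n), ZMod.card]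
  split_ifs
  · rw [one_div, inv_mul_cancel₀ hn0, Complex.one_re]
  · simp

/-- Separation of variables: the second difference in x multiplies mode k by -freq k², so each mode
needs a profile of mass freq k². -/
theorem poisson_harmonic (M : ℕ) (x : ZMod n) (j : ℕ) :
    4 * poisson M x (j + 1) = poisson M (x + 1) (j + 1) + poisson M (x - 1) (j + 1) +
      poisson M x (j + 2) + poisson M x j := by
  have h : 4 * poissonC M x (j + 1) = poissonC M (x + 1) (j + 1) + poissonC M (x - 1) (j + 1) +
      poissonC M x (j + 2) + poissonC M x j := by
    simp only [poissonC]
    rw [mul_left_comm, ← mul_add, ← mul_add, ← mul_add, Finset.mul_sum, ← Finset.sum_add_distrib,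
      ← Finset.sum_add_distrib, ← Finset.sum_add_distrib]
    congr 1
    refine Finset.sum_congr rfl fun k _ => ?_
    have r := congrArg (fun t : ℝ => (t : ℂ)) (profile_recurrence (freq k ^ 2) M j)
    simp only [freq_sq] at r ⊢
    push_cast at r
    have e1 : (ZMod.stdAddChar (k * (x + 1)) : ℂ) = ZMod.stdAddChar (k * x) * ZMod.stdAddChar k := by
      rw [← AddChar.map_add_eq_mul]; congr 1; ring
    have e2 : (ZMod.stdAddChar (k * (x - 1)) : ℂ) =
        ZMod.stdAddChar (k * x) * (starRingEnd ℂ) (ZMod.stdAddChar k) := by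
      rw [← AddChar.map_neg_eq_conj, ← AddChar.map_add_eq_mul]; congr 1; ring
    have e3 := Complex.add_conj (ZMod.stdAddChar k : ℂ)
    push_cast at e3
    rw [e1, e2]
    set p := (profile (2 - 2 * (ZMod.stdAddChar k : ℂ).re) M (j + 1) : ℂ)
    linear_combination (ZMod.stdAddChar (k * x) : ℂ) * r - (ZMod.stdAddChar (k * x) : ℂ) * p * e3
  have := congrArg Complex.re h
  simpa [poisson] using this

theorem sum_poisson_sq_le (M j : ℕ) :
    ∑ x : ZMod n, poisson M x j ^ 2 ≤ (1 / n : ℝ) * ∑ k : ZMod n, profile (freq k ^ 2) M j ^ 2 := by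
  rw [← sum_norm_sq_inverse_dft]
  refine Finset.sum_le_sum fun x _ => ?_
  rw [← sq_abs]
  exact pow_le_pow_left₀ (abs_nonneg _) (Complex.abs_re_le_norm _) 2

/-- Here `freq x` plays the role of a position, comparable to the distance of x from 0 divided by n.
Multiplication by e^{2πix/n} - 1 in space is a unit difference in frequency, so Parseval turns the
spatial weight into differences of consecutive profiles. -/
theorem sum_freq_sq_mul_poisson_sq_le (M j : ℕ) :
    ∑ x : ZMod n, freq x ^ 2 * poisson M x j ^ 2 ≤
      (1 / n : ℝ) * ∑ k : ZMod n,
        (profile (freq (k - 1) ^ 2) M j - profile (freq k ^ 2) M j) ^ 2 := by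
  rw [← sum_norm_sq_inverse_dft]
  refine Finset.sum_le_sum fun x _ => ?_
  have e : (1 / n : ℂ) * ∑ k : ZMod n, ZMod.stdAddChar (k * x) *
      ((profile (freq (k - 1) ^ 2) M j - profile (freq k ^ 2) M j : ℝ) : ℂ) =
      ((ZMod.stdAddChar x : ℂ) - 1) * poissonC M x j := by
    rw [poissonC, mul_left_comm]
    congr 1
    have h1 : ∑ k : ZMod n, (ZMod.stdAddChar (k * x) : ℂ) * (profile (freq (k - 1) ^ 2) M j : ℂ) =
        ZMod.stdAddChar x * ∑ k : ZMod n, ZMod.stdAddChar (k * x) *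
          (profile (freq k ^ 2) M j : ℂ) := by
      rw [← Equiv.sum_comp (Equiv.addRight (1 : ZMod n)), Finset.mul_sum]
      refine Finset.sum_congr rfl fun k _ => ?_
      simp only [Equiv.coe_addRight, add_sub_cancel_right]
      rw [show (k + 1) * x = x + k * x by ring, AddChar.map_add_eq_mul, mul_assoc]
    rw [sub_mul, one_mul, ← h1, ← Finset.sum_sub_distrib]
    refine Finset.sum_congr rfl fun k _ => ?_
    push_cast; ring
  rw [e, norm_mul, mul_pow, freq]
  refine mul_le_mul_of_nonneg_left ?_ (by positivity)
  rw [← sq_abs]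
  exact pow_le_pow_left₀ (abs_nonneg _) (Complex.abs_re_le_norm _) 2

/-- After Parseval, the zero mode costs at most n², since the height is at most n, and the other
modes cost ∑ 1/freq² ≤ n²/4. -/
theorem sum_height_sq_mul_poisson_sq_le (hn : 2 ≤ n) {M j : ℕ} (hM : 0 < M) (hj : j ≤ M)
    (hMn : M - j ≤ n) :
    ∑ x : ZMod n, ((M - j : ℕ) : ℝ) ^ 2 * poisson M x j ^ 2 ≤ 5 / 4 * n := by
  have hn0 : (0 : ℝ) < n := by exact_mod_cast (by omega : 0 < n)
  have hY : ((M - j : ℕ) : ℝ) ≤ n := by exact_mod_cast hMn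
  have h1 : ∑ k : ZMod n, ((M - j : ℕ) : ℝ) ^ 2 * profile (freq k ^ 2) M j ^ 2 ≤
      (n : ℝ) ^ 2 + (n : ℝ) ^ 2 / 4 := by
    rw [← Finset.add_sum_erase _ _ (Finset.mem_univ (0 : ZMod n))]
    refine add_le_add ?_ ?_
    · have p0 := profile_nonneg (sq_nonneg (freq (0 : ZMod n))) hM j
      have p1 := profile_le_one (sq_nonneg (freq (0 : ZMod n))) hM hj
      calc _ ≤ (n : ℝ) ^ 2 * 1 ^ 2 := by gcongr
        _ = _ := by ring
    · refine le_trans ?_ (sum_one_div_freq_sq_le hn)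
      rw [show (Finset.univ.erase (0 : ZMod n)) = Finset.univ.filter (fun k => k ≠ 0) by
        ext; simp]
      exact Finset.sum_le_sum fun k hk =>
        sq_mul_sq_profile_le (pow_pos (freq_pos (Finset.mem_filter.mp hk).2) 2) hM hj
  rw [← Finset.mul_sum] at h1 ⊢
  calc _ ≤ ((M - j : ℕ) : ℝ) ^ 2 * ((1 / n : ℝ) * ∑ k : ZMod n, profile (freq k ^ 2) M j ^ 2) := by
        gcongr; exact sum_poisson_sq_le M j
    _ = (1 / n : ℝ) * (((M - j : ℕ) : ℝ) ^ 2 * ∑ k : ZMod n, profile (freq k ^ 2) M j ^ 2) := by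
        ring
    _ ≤ (1 / n : ℝ) * ((n : ℝ) ^ 2 + (n : ℝ) ^ 2 / 4) := by gcongr
    _ = _ := by field_simp; ring

/-- Consecutive nonzero frequencies a, b differ by at most d = 7/n and are at least 4/n, so they are
comparable. Hence |a² - b²| ≤ d (a + b) ≤ 4 d c for c either of them, and 784 = 16 · 7². -/
theorem sq_profile_shift_le (hn : 2 ≤ n) {M j : ℕ} (hM : 0 < M) (hj : j ≤ M) {k : ZMod n}
    (hk : k ≠ 0) (hk1 : k - 1 ≠ 0) :
    (profile (freq (k - 1) ^ 2) M j - profile (freq k ^ 2) M j) ^ 2 ≤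
      784 / (n : ℝ) ^ 2 * (1 / freq (k - 1) ^ 2 + 1 / freq k ^ 2) := by
  have hn0 : (0 : ℝ) < n := by exact_mod_cast (by omega : 0 < n)
  have ha := freq_pos hk1
  have hb := freq_pos hk
  have ha4 := four_div_le_freq hk1
  have hb4 := four_div_le_freq hk
  have h1 := freq_one_le (n := n) hn
  have hab : freq (k - 1) ≤ freq k + 7 / n := by
    have := freq_add_le k (-1 : ZMod n)
    rw [freq_neg, ← sub_eq_add_neg] at this
    linarith
  have hba : freq k ≤ freq (k - 1) + 7 / n := by
    have := freq_add_le (k - 1) (1 : ZMod n)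
    rw [sub_add_cancel] at this
    linarith
  refine (sq_profile_sub_le (pow_pos ha 2) (pow_pos hb 2) hM hj).trans ?_
  set a := freq (k - 1)
  set b := freq k
  set d : ℝ := 7 / n with hd
  have hd0 : 0 < d := by positivity
  have hda : d ≤ 2 * a := by
    have : d ≤ 2 * (4 / n) := by rw [hd, ← mul_div_assoc]; gcongr; norm_num
    linarith
  have hdb : d ≤ 2 * b := by
    have : d ≤ 2 * (4 / n) := by rw [hd, ← mul_div_assoc]; gcongr; norm_num
    linarith
  have hsub : (a - b) ^ 2 ≤ d ^ 2 := by
    rw [sq_le_sq, abs_of_pos hd0, abs_le]; constructor <;> linarith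
  have hdiff : (a ^ 2 - b ^ 2) ^ 2 = (a - b) ^ 2 * (a + b) ^ 2 := by ring
  have hd2 : 784 / (n : ℝ) ^ 2 = 16 * d ^ 2 := by rw [hd]; ring
  have key : ∀ c : ℝ, 0 < c → a + b ≤ 4 * c →
      (a ^ 2 - b ^ 2) ^ 2 / (c ^ 2) ^ 2 ≤ 16 * d ^ 2 * (1 / c ^ 2) := by
    intro c hc habc
    have h2 : (a + b) ^ 2 ≤ (4 * c) ^ 2 := pow_le_pow_left₀ (by positivity) habc 2
    calc _ ≤ d ^ 2 * (4 * c) ^ 2 / (c ^ 2) ^ 2 := by rw [hdiff]; gcongr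
      _ = _ := by field_simp; ring
  rw [hd2, mul_add]
  exact add_le_add (key a ha (by linarith)) (key b hb (by linarith))

theorem sum_freq_sq_mul_poisson_sq_le_div (hn : 2 ≤ n) {M j : ℕ} (hM : 0 < M) (hj : j ≤ M) :
    ∑ x : ZMod n, freq x ^ 2 * poisson M x j ^ 2 ≤ 394 / n := by
  have hn0 : (0 : ℝ) < n := by exact_mod_cast (by omega : 0 < n)
  refine (sum_freq_sq_mul_poisson_sq_le M j).trans ?_
  rw [one_div_mul_eq_div]
  gcongr
  set D : ZMod n → ℝ := fun k => (profile (freq (k - 1) ^ 2) M j - profile (freq k ^ 2) M j) ^ 2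
  have hD1 : ∀ k, D k ≤ 1 := by
    intro k
    have p0 := profile_nonneg (sq_nonneg (freq k)) hM j
    have p1 := profile_le_one (sq_nonneg (freq k)) hM hj
    have q0 := profile_nonneg (sq_nonneg (freq (k - 1))) hM j
    have q1 := profile_le_one (sq_nonneg (freq (k - 1))) hM hj
    exact (sq_le_one_iff_abs_le_one _).mpr (abs_le.mpr ⟨by linarith, by linarith⟩)
  set z : ZMod n → ℝ := fun k => if k = 0 then 0 else 1 / freq k ^ 2 with hz
  have hz0 : ∀ k, 0 ≤ z k := fun k => by simp only [hz]; split_ifs <;> positivity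
  -- The two differences that involve the zero mode, at k = 0 and k = 1, are bounded trivially by 1
  -- each; with 784 · 2/4 = 392 this gives 394.
  have hterm : ∀ k, D k ≤ (if k = 0 then 1 else 0) + (if k - 1 = 0 then 1 else 0) +
      784 / (n : ℝ) ^ 2 * (z (k - 1) + z k) := by
    intro k
    have hnn : 0 ≤ 784 / (n : ℝ) ^ 2 * (z (k - 1) + z k) :=
      mul_nonneg (by positivity) (add_nonneg (hz0 _) (hz0 _))
    by_cases hk : k = 0
    · rw [if_pos hk]
      have := hD1 k
      split_ifs <;> linarith
    · by_cases hk1 : k - 1 = 0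
      · rw [if_neg hk, if_pos hk1]
        linarith [hD1 k]
      · rw [if_neg hk, if_neg hk1]
        simp only [hz, if_neg hk, if_neg hk1, zero_add]
        exact sq_profile_shift_le hn hM hj hk hk1
  have hzsum : ∑ k, z k ≤ (n : ℝ) ^ 2 / 4 := by
    refine le_of_eq_of_le ?_ (sum_one_div_freq_sq_le hn)
    rw [Finset.sum_filter]
    refine Finset.sum_congr rfl fun k _ => ?_
    by_cases hk : k = 0 <;> simp [hz, hk]
  have hshift : ∀ F : ZMod n → ℝ, ∑ k, F (k - 1) = ∑ k, F k := fun F =>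
    Equiv.sum_comp (Equiv.subRight (1 : ZMod n)) F
  calc ∑ k, D k ≤ ∑ k, ((if k = 0 then 1 else 0) + (if k - 1 = 0 then 1 else 0) +
        784 / (n : ℝ) ^ 2 * (z (k - 1) + z k)) := Finset.sum_le_sum fun k _ => hterm k
    _ = 2 + 784 / (n : ℝ) ^ 2 * (2 * ∑ k, z k) := by
        rw [Finset.sum_add_distrib, Finset.sum_add_distrib, ← Finset.mul_sum,
          Finset.sum_add_distrib, hshift z, hshift (fun k => if k = 0 then 1 else 0)]
        simp only [Finset.sum_ite_eq', Finset.mem_univ, if_true]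
        ring
    _ ≤ 2 + 784 / (n : ℝ) ^ 2 * (2 * ((n : ℝ) ^ 2 / 4)) := by gcongr
    _ = 394 := by field_simp; norm_num

end CylinderGreen

/-! ### Maximum principle -/

namespace CRSF

section MaximumPrinciple

variable {W : Type*} [Fintype W] [DecidableEq W]

/-- A negative minimum would be attained inside S, where superharmonicity passes it on to all
neighbours, and connectedness would carry it to `r`. -/
theorem nonneg_of_realLap_nonneg {G : SimpleGraph W} (hG : G.Preconnected) {r : W} {S : Finset W}
    (hr : r ∉ S) {h : W → ℝ} (hoff : ∀ u, u ∉ S → 0 ≤ h u) (hS : ∀ u ∈ S, 0 ≤ realLap G h u)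
    (v : W) : 0 ≤ h v := by
  classical
  by_contra hneg
  push Not at hneg
  obtain ⟨u₀, -, hmin⟩ := Finset.exists_min_image Finset.univ h ⟨v, Finset.mem_univ v⟩
  have hm : h u₀ < 0 := (hmin v (Finset.mem_univ v)).trans_lt hneg
  have hstep : ∀ u w, h u = h u₀ → G.Adj u w → h w = h u₀ := by
    intro u w hu huw
    have huS : u ∈ S := by
      by_contra hc
      have := hoff u hc
      linarith
    have hnp : ∀ x ∈ Finset.univ, (if G.Adj u x then h u - h x else 0) ≤ 0 := by
      intro x _
      split_ifs
      · have := hmin x (Finset.mem_univ x); linarith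
      · exact le_rfl
    have h0 := (Finset.sum_eq_zero_iff_of_nonpos hnp).mp
      (le_antisymm (Finset.sum_nonpos hnp) (hS u huS)) w (Finset.mem_univ w)
    rw [if_pos huw] at h0
    linarith
  obtain ⟨p⟩ := hG u₀ r
  have hall : ∀ a b, G.Walk a b → h a = h u₀ → h b = h u₀ := by
    intro a b q
    induction q with
    | nil => exact id
    | cons hadj q ih => exact fun ha => ih (hstep _ _ ha hadj)
  have := hall u₀ r p rfl
  have := hoff r hr
  linarith

theorem realLap_smul_sub {G : SimpleGraph W} (c : ℝ) (f g : W → ℝ) (u : W) :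
    realLap G (fun w => c * f w - g w) u = c * realLap G f u - realLap G g u := by
  classical
  rw [realLap, realLap, realLap, Finset.mul_sum, ← Finset.sum_sub_distrib]
  refine Finset.sum_congr rfl fun w _ => ?_
  split_ifs <;> ring

theorem realLap_const_sub {G : SimpleGraph W} (c : ℝ) (g : W → ℝ) (u : W) :
    realLap G (fun w => c - g w) u = - realLap G g u := by
  classical
  rw [realLap, realLap, ← Finset.sum_neg_distrib]
  refine Finset.sum_congr rfl fun w _ => ?_
  split_ifs <;> ring

end MaximumPrinciple

end CRSF

/-! ### The wired cylinder as a graph and its Green's function -/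

namespace Cylinder

open CRSF

variable {n : ℕ}

/-- The neighbour above a vertex of the cylinder. -/
def upNbr (x : ZMod n) (y : Fin n) : Option (ZMod n × Fin n) :=
  if h : y.val + 1 < n then some (x, ⟨y.val + 1, h⟩) else none

/-- The neighbour below a vertex of the cylinder. -/
def downNbr (x : ZMod n) (y : Fin n) : Option (ZMod n × Fin n) :=
  if 0 < y.val then some (x, ⟨y.val - 1, by omega⟩) else none

theorem add_one_ne_self (hn : 3 ≤ n) (x : ZMod n) : x + 1 ≠ x := by
  have : Fact (1 < n) := ⟨by omega⟩
  simp

theorem add_one_ne_sub_one (hn : 3 ≤ n) (x : ZMod n) : x + 1 ≠ x - 1 := by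
  intro h
  have h2 : ((2 : ℕ) : ZMod n) = 0 := by
    push_cast
    linear_combination h
  rw [ZMod.natCast_eq_zero_iff] at h2
  have := Nat.le_of_dvd (by norm_num) h2
  omega

theorem adj_some_iff (hn : 3 ≤ n) (x : ZMod n) (y : Fin n) (w : Option (ZMod n × Fin n)) :
    (wiredCylinder n).Adj (some (x, y)) w ↔
      w = some (x + 1, y) ∨ w = some (x - 1, y) ∨ w = upNbr x y ∨ w = downNbr x y := by
  have hx1 := add_one_ne_self hn
  rw [wiredCylinder, SimpleGraph.fromRel_adj]
  rcases w with _ | ⟨x', y'⟩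
  · simp only [upNbr, downNbr]
    have := y.2
    split_ifs <;> simp <;> omega
  · have hup : some (x', y') = upNbr x y ↔ x' = x ∧ y'.val = y.val + 1 := by
      rw [upNbr]
      split_ifs with h
      · simp [Fin.ext_iff]
      · have := y'.2
        simp only [false_iff, not_and]
        omega
    have hdown : some (x', y') = downNbr x y ↔ x' = x ∧ y.val = y'.val + 1 := by
      rw [downNbr]
      split_ifs with h
      · simp only [Option.some.injEq, Prod.mk.injEq, Fin.ext_iff]
        refine and_congr_right fun _ => by omega
      · simp only [false_iff, not_and]
        omega
    rw [hup, hdown]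
    simp only [ne_eq, Option.some.injEq, Prod.mk.injEq]
    have hsub : x = x' + 1 ↔ x' = x - 1 := by
      constructor
      · rintro rfl; ring
      · rintro rfl; ring
    rw [hsub]
    constructor
    · rintro ⟨-, (h | h) | (h | h)⟩
      · exact Or.inl h
      · exact Or.inr (Or.inr (Or.inl h))
      · exact Or.inr (Or.inl ⟨h.1, h.2.symm⟩)
      · exact Or.inr (Or.inr (Or.inr ⟨h.1.symm, h.2⟩))
    · rintro (⟨rfl, rfl⟩ | ⟨rfl, rfl⟩ | ⟨rfl, h⟩ | ⟨rfl, h⟩)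
      · exact ⟨fun h => hx1 x h.1.symm, Or.inl (Or.inl ⟨rfl, rfl⟩)⟩
      · refine ⟨fun h => hx1 (x - 1) ?_, Or.inr (Or.inl ⟨rfl, rfl⟩)⟩
        rw [sub_add_cancel]; exact h.1
      · exact ⟨fun h' => by rw [h'.2] at h; omega, Or.inl (Or.inr ⟨rfl, h⟩)⟩
      · exact ⟨fun h' => by rw [h'.2] at h; omega, Or.inr (Or.inr ⟨rfl, h⟩)⟩

theorem preconnected (hn : 3 ≤ n) : (wiredCylinder n).Preconnected := by
  have h : ∀ (k : ℕ) (x : ZMod n) (hk : k < n),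
      (wiredCylinder n).Reachable (some (x, ⟨k, hk⟩)) none := by
    intro k
    induction k with
    | zero =>
      intro x hk
      refine SimpleGraph.Adj.reachable ((adj_some_iff hn _ _ _).mpr ?_)
      right; right; right
      simp [downNbr]
    | succ k ih =>
      intro x hk
      refine SimpleGraph.Reachable.trans ?_ (ih x (by omega))
      refine SimpleGraph.Adj.reachable ((adj_some_iff hn _ _ _).mpr ?_)
      right; right; right
      simp [downNbr]
  have h' : ∀ v, (wiredCylinder n).Reachable v none := by
    rintro (_ | ⟨x, k, hk⟩)
    · exact SimpleGraph.Reachable.refl _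
    · exact h k x hk
  exact fun u v => (h' u).trans (h' v).symm

-- For n ≥ 3 the four neighbours are distinct: the horizontal ones since n does not divide 2, the
-- vertical ones since no row is both the bottom and the top. Thus every vertex has degree 4, the
-- wired vertex included among the neighbours.
open Classical in
theorem sum_adj_some [NeZero n] (hn : 3 ≤ n) (x : ZMod n) (y : Fin n)
    (F : Option (ZMod n × Fin n) → ℝ) :
    ∑ w, (if (wiredCylinder n).Adj (some (x, y)) w then F w else 0) =
      F (some (x + 1, y)) + F (some (x - 1, y)) + F (upNbr x y) + F (downNbr x y) := by
  have hx1 := add_one_ne_self hn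
  have hud : upNbr x y ≠ downNbr x y := by
    have := y.2
    simp only [upNbr, downNbr]
    split_ifs
    · simp [Fin.ext_iff]; omega
    · simp
    · simp
    · omega
  have hu : ∀ x' : ZMod n, some (x', y) ≠ upNbr x y := by
    intro x' h
    simp only [upNbr] at h
    split_ifs at h
    simp [Fin.ext_iff] at h
  have hd : ∀ x' : ZMod n, some (x', y) ≠ downNbr x y := by
    intro x' h
    simp only [downNbr] at h
    split_ifs at h with h'
    simp only [Option.some.injEq, Prod.mk.injEq, Fin.ext_iff] at h
    omega
  have hset : (Finset.univ.filter fun w => (wiredCylinder n).Adj (some (x, y)) w) =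
      {some (x + 1, y), some (x - 1, y), upNbr x y, downNbr x y} := by
    ext w
    simp [adj_some_iff hn]
  have h12 : (some (x + 1, y) : Option (ZMod n × Fin n)) ≠ some (x - 1, y) := by
    simp only [ne_eq, Option.some.injEq, Prod.mk.injEq, and_true]
    exact add_one_ne_sub_one hn x
  rw [← Finset.sum_filter, hset, Finset.sum_insert, Finset.sum_insert, Finset.sum_pair hud]
  · ring
  · simp [hu, hd]
  · simp only [Finset.mem_insert, Finset.mem_singleton, not_or]
    exact ⟨h12, hu _, hd _⟩

theorem realLap_some [NeZero n] (hn : 3 ≤ n) (h : Option (ZMod n × Fin n) → ℝ) (x : ZMod n)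
    (y : Fin n) : realLap (wiredCylinder n) h (some (x, y)) =
      4 * h (some (x, y)) - (h (some (x + 1, y)) + h (some (x - 1, y)) + h (upNbr x y) +
        h (downNbr x y)) := by
  classical
  have := sum_adj_some hn x y (fun w => h (some (x, y)) - h w)
  rw [realLap]
  refine Eq.trans ?_ (this.trans (by ring))
  exact Finset.sum_congr rfl fun w _ => by congr

/-- The row of a vertex of the wired cylinder. -/
def row : Option (ZMod n × Fin n) → ℕ
  | none => 0
  | some (_, y) => y.val

open CylinderGreen

/-- The Green's function, with pole `(x₀, m)`, of the rows `0, …, m` of the cylinder with Dirichlet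
boundary conditions. -/
noncomputable def green [NeZero n] (x₀ : ZMod n) (m : ℕ) : Option (ZMod n × Fin n) → ℝ
  | none => 0
  | some (x, y) => if y.val ≤ m then poisson (m + 2) (x - x₀) (y.val + 1) else 0

/-- A Poisson kernel whose boundary source sits directly above the pole, cut off to zero from row m
+ 1 on. Heights are shifted by one, so that height 0 stands for the wired vertex and height m + 2
for row m + 1. -/
theorem realLap_green [NeZero n] (hn : 3 ≤ n) (x₀ : ZMod n) {m : ℕ} (hm : m < n) (x : ZMod n)
    (y : Fin n) (hy : y.val ≤ m) :
    realLap (wiredCylinder n) (green x₀ m) (some (x, y)) =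
      if x = x₀ ∧ y.val = m then 1 else 0 := by
  rw [realLap_some hn]
  have hd : green x₀ m (downNbr x y) = poisson (m + 2) (x - x₀) y.val := by
    simp only [downNbr]
    split_ifs with h
    · simp only [green]
      rw [if_pos (by omega), Nat.sub_add_cancel (by omega)]
    · have : y.val = 0 := by omega
      rw [this, poisson_zero]; rfl
  -- The cutoff replaces the source value 1 above the pole by 0, and this is where the unit mass
  -- comes from.
  have hu : green x₀ m (upNbr x y) =
      poisson (m + 2) (x - x₀) (y.val + 2) - if x = x₀ ∧ y.val = m then 1 else 0 := by
    by_cases hym : y.val = m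
    · have h1 : green x₀ m (upNbr x y) = 0 := by
        simp only [upNbr]
        split_ifs with h
        · simp only [green]
          rw [if_neg (by omega)]
        · rfl
      rw [h1, hym, poisson_self (by omega)]
      simp [sub_eq_zero]
    · rw [upNbr, dif_pos (by omega)]
      simp only [green]
      rw [if_pos (by omega), if_neg (by tauto), sub_zero]
  rw [hu, hd]
  simp only [green, if_pos hy]
  have := poisson_harmonic (m + 2) (x - x₀) y.val
  rw [show x - x₀ + 1 = x + 1 - x₀ by ring, show x - x₀ - 1 = x - 1 - x₀ by ring] at this
  linarith

theorem green_nonneg [NeZero n] (hn : 3 ≤ n) (x₀ : ZMod n) {m : ℕ} (hm : m < n)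
    (u : Option (ZMod n × Fin n)) : 0 ≤ green x₀ m u := by
  classical
  refine nonneg_of_realLap_nonneg (preconnected hn) (r := none)
    (S := Finset.univ.filter fun u => u ≠ none ∧ row u ≤ m) (by simp) ?_ ?_ u
  · rintro (_ | ⟨x, y⟩) hu
    · exact le_rfl
    · have hu' : ¬ y.val ≤ m := fun h =>
        hu (Finset.mem_filter.mpr ⟨Finset.mem_univ _, by simp, h⟩)
      simp only [green]
      rw [if_neg hu']
  · rintro (_ | ⟨x, y⟩) hu
    · simp at hu
    · rw [realLap_green hn x₀ hm x y (Finset.mem_filter.mp hu).2.2]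
      split_ifs <;> norm_num

/-- A function that is harmonic on a set of vertices below row `m`, equal to `1` at `(x₀, m)` and
zero elsewhere, is dominated by the Green's function. -/
theorem harmonic_bounds [NeZero n] (hn : 3 ≤ n) (x₀ : ZMod n) (y₀ : Fin n)
    {S : Finset (Option (ZMod n × Fin n))} (hnone : none ∉ S) (hrow : ∀ u ∈ S, row u ≤ y₀.val)
    {h : Option (ZMod n × Fin n) → ℝ} (h1 : h (some (x₀, y₀)) = 1)
    (h0 : ∀ u, u ∉ insert (some (x₀, y₀)) S → h u = 0)
    (hharm : ∀ u ∈ S, realLap (wiredCylinder n) h u = 0) (u : Option (ZMod n × Fin n)) :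
    0 ≤ h u ∧ h u ≤ 1 ∧ h u ≤ 4 * green x₀ y₀.val u := by
  have hoff : ∀ u, u ∉ S → u = some (x₀, y₀) ∨ h u = 0 := by
    intro u hu
    by_cases he : u = some (x₀, y₀)
    · exact Or.inl he
    · exact Or.inr (h0 u (by simp [he, hu]))
  have hpre := preconnected hn
  refine ⟨?_, ?_, ?_⟩
  · refine nonneg_of_realLap_nonneg hpre hnone (fun u hu => ?_) (fun u hu => (hharm u hu).ge) u
    rcases hoff u hu with rfl | h
    · rw [h1]; norm_num
    · exact h.ge
  · have := nonneg_of_realLap_nonneg hpre hnone (h := fun w => 1 - h w) (fun u hu => ?_)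
      (fun u hu => ?_) u
    · linarith
    · rcases hoff u hu with rfl | h
      · simp [h1]
      · simp [h]
    · rw [realLap_const_sub, hharm u hu, neg_zero]
  · have := nonneg_of_realLap_nonneg hpre hnone (h := fun w => 4 * green x₀ y₀.val w - h w)
      (fun u hu => ?_) (fun u hu => ?_) u
    · linarith
    · rcases hoff u hu with rfl | h
      · have h2 := realLap_green hn x₀ y₀.2 x₀ y₀ le_rfl
        rw [realLap_some hn, if_pos ⟨rfl, rfl⟩] at h2
        have g := green_nonneg hn x₀ y₀.2
        have g1 := g (some (x₀ + 1, y₀))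
        have g2 := g (some (x₀ - 1, y₀))
        have g3 := g (upNbr x₀ y₀)
        have g4 := g (downNbr x₀ y₀)
        rw [h1]
        linarith
      · rw [h]
        have := green_nonneg hn x₀ y₀.2 u
        linarith
    · rw [realLap_smul_sub, hharm u hu, sub_zero]
      rcases u with _ | ⟨x, y⟩
      · exact absurd hu hnone
      · rw [realLap_green hn x₀ y₀.2 x y (hrow _ hu)]
        split_ifs <;> norm_num

theorem upNbr_notMem (x₀ : ZMod n) (y₀ : Fin n)
    {S : Finset (Option (ZMod n × Fin n))} (hnone : none ∉ S) (hrow : ∀ u ∈ S, row u ≤ y₀.val) :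
    upNbr x₀ y₀ ∉ insert (some (x₀, y₀)) S := by
  rw [Finset.mem_insert, not_or]
  simp only [upNbr]
  split_ifs with h
  · refine ⟨by simp [Fin.ext_iff], fun hS => ?_⟩
    have := hrow _ hS
    simp [row] at this
  · exact ⟨by simp, hnone⟩

/-- The energy is the Laplacian at the pole: 4 minus the neighbouring values, of which the upper one
vanishes and the other three are at most 1. -/
theorem one_le_energy [NeZero n] (hn : 3 ≤ n) (x₀ : ZMod n) (y₀ : Fin n)
    {S : Finset (Option (ZMod n × Fin n))} (hnone : none ∉ S) (hrow : ∀ u ∈ S, row u ≤ y₀.val)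
    {h : Option (ZMod n × Fin n) → ℝ} (h1 : h (some (x₀, y₀)) = 1)
    (h0 : ∀ u, u ∉ insert (some (x₀, y₀)) S → h u = 0)
    (hharm : ∀ u ∈ S, realLap (wiredCylinder n) h u = 0) :
    1 ≤ energy (Connection.trivial (wiredCylinder n)) (fun u => (h u : ℂ)) := by
  have he := lapOp_eq_energy (h := fun u => (h u : ℂ)) (v := some (x₀, y₀)) (S := S)
    (Connection.trivial (wiredCylinder n)) (by simp [h1]) (fun u hu => by simp [h0 u hu])
    (fun u hu => by rw [lapOp_trivial, hharm u hu]; simp)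
  rw [lapOp_trivial] at he
  rw [← Complex.ofReal_injective he, realLap_some hn, h1,
    h0 _ (upNbr_notMem x₀ y₀ hnone hrow)]
  have hb := harmonic_bounds hn x₀ y₀ hnone hrow h1 h0 hharm
  linarith [(hb (some (x₀ + 1, y₀))).2.1, (hb (some (x₀ - 1, y₀))).2.1, (hb (downNbr x₀ y₀)).2.1]

end Cylinder

/-! ### Choice of gauge and the excess energy -/

namespace Cylinder

open CRSF CylinderGreen

variable {n : ℕ}

theorem prod_zmod_eq_prod_range [NeZero n] {A : Type*} [CommMonoid A] (f : ZMod n → A) :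
    ∏ x, f x = ∏ i ∈ Finset.range n, f (i : ZMod n) := by
  refine Finset.prod_nbij' (fun x => x.val) (fun i => (i : ZMod n)) ?_ ?_ ?_ ?_ ?_
  · intro x _; exact Finset.mem_range.mpr (ZMod.val_lt x)
  · simp
  · intro x _; exact ZMod.natCast_zmod_val x
  · intro i hi; exact ZMod.val_natCast_of_lt (Finset.mem_range.mp hi)
  · intro x _; rw [ZMod.natCast_zmod_val]

/-- Partial products give the potential; the total product being 1 is the condition for closing up
around the circle. -/
theorem exists_ratio_of_prod_eq_one [NeZero n] (f : ZMod n → Circle) (hf : ∏ x, f x = 1) :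
    ∃ l : ZMod n → Circle, ∀ x, l (x + 1) = l x * f x := by
  refine ⟨fun x => ∏ i ∈ Finset.range x.val, f (i : ZMod n), fun x => ?_⟩
  have hx := ZMod.val_lt x
  have hprod : (∏ i ∈ Finset.range x.val, f (i : ZMod n)) * f x =
      ∏ i ∈ Finset.range (x.val + 1), f (i : ZMod n) := by
    rw [Finset.prod_range_succ, ZMod.natCast_zmod_val]
  simp only [hprod]
  have hval : (x + 1).val = (x.val + 1) % n := by
    conv_lhs => rw [← ZMod.natCast_zmod_val x, ← Nat.cast_one, ← Nat.cast_add, ZMod.val_natCast]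
  rw [hval]
  rcases (Nat.succ_le_of_lt hx).eq_or_lt with h | h
  · rw [show x.val + 1 = n from h, Nat.mod_self, Finset.prod_range_zero,
      ← prod_zmod_eq_prod_range, hf]
  · rw [Nat.mod_eq_of_lt h]

theorem adj_horizontal (hn : 3 ≤ n) (x : ZMod n) (y : Fin n) :
    (wiredCylinder n).Adj (some (x, y)) (some (x + 1, y)) :=
  (adj_some_iff hn _ _ _).mpr (Or.inl rfl)

theorem adj_vertical (hn : 3 ≤ n) (x : ZMod n) (y y' : Fin n) (h : y'.val = y.val + 1) :
    (wiredCylinder n).Adj (some (x, y)) (some (x, y')) := by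
  refine (adj_some_iff hn _ _ _).mpr (Or.inr (Or.inr (Or.inl ?_)))
  rw [upNbr, dif_pos (by omega)]
  simp [Fin.ext_iff, h]

/-- A connection of constant curvature on the cylinder is gauge equivalent to any prescribed one
with trivial vertical transport and with the same horizontal monodromies. -/
theorem exists_gauge [NeZero n] (hn : 3 ≤ n) (Φ : Connection (wiredCylinder n)) {φ : ℝ}
    (hface : HasFaceMonodromy Φ φ) (hbot : HasTrivialBottomMonodromy Φ) (b : ZMod n → ℝ)
    (hb : ∑ x, b x = 0) :
    ∃ l : Option (ZMod n × Fin n) → Circle,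
      (∀ x (y y' : Fin n), y'.val = y.val + 1 →
        (l (some (x, y)))⁻¹ * Φ.transport (some (x, y)) (some (x, y')) * l (some (x, y')) = 1) ∧
      ∀ x (y : Fin n), (l (some (x, y)))⁻¹ * Φ.transport (some (x, y)) (some (x + 1, y)) *
        l (some (x + 1, y)) = Circle.exp (φ * y.val + b x) := by
  have hexp : ∏ x, Circle.exp (b x) = 1 := by
    have : ∀ s : Finset (ZMod n), ∏ x ∈ s, Circle.exp (b x) = Circle.exp (∑ x ∈ s, b x) := by
      intro s
      induction s using Finset.induction_on with
      | empty => simp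
      | insert a s ha ih => rw [Finset.prod_insert ha, Finset.sum_insert ha, Circle.exp_add, ih]
    rw [this, hb, Circle.exp_zero]
  obtain ⟨l₀, hl₀⟩ := exists_ratio_of_prod_eq_one
    (fun x => (Φ.transport (some (x, 0)) (some (x + 1, 0)))⁻¹ * Circle.exp (b x)) (by
      rw [Finset.prod_mul_distrib, Finset.prod_inv_distrib, hexp, hbot, inv_one, one_mul])
  -- The bottom row fixes the horizontal phases; upwards the gauge undoes the vertical transport,
  -- and the value 1 past the top row is never used. The face monodromy then adds φ to the
  -- horizontal phase at each row.
  let L : ZMod n → ℕ → Circle := fun x j => Nat.rec (l₀ x) (fun j a =>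
    if h : j + 1 < n then
      (Φ.transport (some (x, ⟨j, by omega⟩)) (some (x, ⟨j + 1, h⟩)))⁻¹ * a else 1) j
  have hL0 : ∀ x, L x 0 = l₀ x := fun x => rfl
  have hLs : ∀ x j (h : j + 1 < n), L x (j + 1) =
      (Φ.transport (some (x, ⟨j, by omega⟩)) (some (x, ⟨j + 1, h⟩)))⁻¹ * L x j := by
    intro x j h
    exact dif_pos h
  refine ⟨fun u => match u with
    | none => 1
    | some (x, y) => L x y.val, ?_, ?_⟩
  · rintro x ⟨y, hy⟩ ⟨y', hy'⟩ h
    obtain rfl : y' = y + 1 := h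
    simp only [hLs x y hy']
    rw [mul_assoc, mul_inv_cancel_left, inv_mul_cancel]
  · rintro x ⟨y, hy⟩
    simp only
    induction y with
    | zero =>
      rw [hL0, hL0, hl₀]
      have h0 : (⟨0, hy⟩ : Fin n) = 0 := by ext; simp
      rw [h0]
      simp only [Nat.cast_zero, mul_zero, zero_add]
      rw [mul_comm (l₀ x), mul_assoc, mul_assoc, mul_inv_cancel_left, mul_comm (l₀ x)⁻¹, mul_assoc,
        mul_inv_cancel, mul_one]
    | succ j ih =>
      have ih := ih (by omega)
      rw [hLs x j hy, hLs (x + 1) j hy]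
      have hf := hface x ⟨j, by omega⟩ ⟨j + 1, hy⟩ rfl
      rw [Φ.transport_symm _ _ (adj_vertical hn (x + 1) ⟨j, by omega⟩ ⟨j + 1, hy⟩ rfl),
        Φ.transport_symm _ _ (adj_horizontal hn x ⟨j, by omega⟩)] at hf
      rw [show φ * ((j + 1 : ℕ) : ℝ) + b x = φ + (φ * j + b x) by push_cast; ring,
        Circle.exp_add, ← ih, ← hf]
      generalize Φ.transport (some (x, ⟨j, _⟩)) (some (x, ⟨j + 1, hy⟩)) = A
      generalize Φ.transport (some (x + 1, ⟨j, _⟩)) (some (x + 1, ⟨j + 1, hy⟩)) = B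
      generalize Φ.transport (some (x, ⟨j, _⟩)) (some (x + 1, ⟨j, _⟩)) = R
      generalize Φ.transport (some (x, ⟨j + 1, hy⟩)) (some (x + 1, ⟨j + 1, hy⟩)) = R'
      generalize L x j = u
      generalize L (x + 1) j = w
      rw [mul_inv_rev, inv_inv]
      calc u⁻¹ * A * R' * (B⁻¹ * w) = A * R' * B⁻¹ * u⁻¹ * w := by
            simp only [mul_comm, mul_left_comm, mul_assoc]
        _ = A * R' * B⁻¹ * (R⁻¹ * R) * u⁻¹ * w := by rw [inv_mul_cancel, mul_one]
        _ = _ := by simp only [mul_comm, mul_left_comm, mul_assoc]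

theorem sum_stdAddChar_re [NeZero n] (hn : 2 ≤ n) (x₀ : ZMod n) :
    ∑ x : ZMod n, (ZMod.stdAddChar (x - x₀) : ℂ).re = 0 := by
  have : Fact (1 < n) := ⟨by omega⟩
  refine (Equiv.sum_comp (Equiv.subRight x₀)
    (fun x : ZMod n => (ZMod.stdAddChar x : ℂ).re)).trans ?_
  rw [← Complex.re_sum]
  have := AddChar.sum_mulShift (1 : ZMod n) (ZMod.isPrimitive_stdAddChar n)
  simp only [mul_one, one_ne_zero, if_false] at this
  rw [this]; simp

theorem circle_inv_re (z : Circle) : ((z⁻¹ : Circle) : ℂ).re = (z : ℂ).re := by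
  rw [Circle.coe_inv_eq_conj, Complex.conj_re]

open Classical in
/-- In a gauge with trivial vertical transport, the excess energy of a nonnegative function that
vanishes at the wired vertex is bounded by a sum over horizontal edges. -/
theorem excess_energy_le [NeZero n] (hn : 3 ≤ n) (Φ : Connection (wiredCylinder n))
    (l : Option (ZMod n × Fin n) → Circle) (θ : ZMod n → Fin n → ℝ)
    (hvert : ∀ x (y y' : Fin n), y'.val = y.val + 1 →
        (l (some (x, y)))⁻¹ * Φ.transport (some (x, y)) (some (x, y')) * l (some (x, y')) = 1)
    (hhor : ∀ x (y : Fin n), (l (some (x, y)))⁻¹ * Φ.transport (some (x, y)) (some (x + 1, y)) *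
        l (some (x + 1, y)) = Circle.exp (θ x y))
    (h : Option (ZMod n × Fin n) → ℝ) (hnone : h none = 0) (hnn : ∀ u, 0 ≤ h u) :
    ∑ u, ∑ w, (if (wiredCylinder n).Adj u w then
        (1 - (((l u)⁻¹ * Φ.transport u w * l w : Circle) : ℂ).re) * (h u * h w) else 0) ≤
      ∑ y : Fin n, ∑ x : ZMod n, θ x y ^ 2 * (h (some (x, y)) * h (some (x + 1, y))) := by
  have hinv : ∀ u w, (wiredCylinder n).Adj u w → (l w)⁻¹ * Φ.transport w u * l u =
      ((l u)⁻¹ * Φ.transport u w * l w)⁻¹ := by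
    intro u w huw
    rw [Φ.transport_symm u w huw, mul_inv_rev, mul_inv_rev, inv_inv, mul_assoc]
  rw [Fintype.sum_option]
  have h0 : ∑ w, (if (wiredCylinder n).Adj none w then
      (1 - (((l none)⁻¹ * Φ.transport none w * l w : Circle) : ℂ).re) * (h none * h w) else 0)
      = 0 := Finset.sum_eq_zero fun w _ => by split_ifs <;> simp [hnone]
  rw [h0, zero_add, Fintype.sum_prod_type_right]
  refine Finset.sum_le_sum fun y _ => ?_
  set F : ZMod n → ℝ := fun x =>
    (1 - Real.cos (θ x y)) * (h (some (x, y)) * h (some (x + 1, y))) with hF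
  have hterm : ∀ x : ZMod n, ∑ w, (if (wiredCylinder n).Adj (some (x, y)) w then
      (1 - (((l (some (x, y)))⁻¹ * Φ.transport (some (x, y)) w * l w : Circle) : ℂ).re) *
        (h (some (x, y)) * h w) else 0) = F x + F (x - 1) := by
    intro x
    rw [sum_adj_some hn x y (fun w =>
      (1 - (((l (some (x, y)))⁻¹ * Φ.transport (some (x, y)) w * l w : Circle) : ℂ).re) *
        (h (some (x, y)) * h w))]
    have e1 := hhor x y
    have e2 := hhor (x - 1) y
    have a2 := hinv _ _ (adj_horizontal hn (x - 1) y)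
    rw [e2, sub_add_cancel] at a2
    have r : ∀ t : ℝ, ((Circle.exp t : Circle) : ℂ).re = Real.cos t := by
      intro t; rw [Circle.coe_exp, Complex.exp_ofReal_mul_I_re]
    rw [e1, a2, circle_inv_re, r, r]
    have eu : (1 - (((l (some (x, y)))⁻¹ * Φ.transport (some (x, y)) (upNbr x y) *
        l (upNbr x y) : Circle) : ℂ).re) * (h (some (x, y)) * h (upNbr x y)) = 0 := by
      simp only [upNbr]
      split_ifs with hy
      · rw [hvert x y ⟨y.val + 1, hy⟩ rfl]; simp
      · simp [hnone]
    have ed : (1 - (((l (some (x, y)))⁻¹ * Φ.transport (some (x, y)) (downNbr x y) *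
        l (downNbr x y) : Circle) : ℂ).re) * (h (some (x, y)) * h (downNbr x y)) = 0 := by
      simp only [downNbr]
      split_ifs with hy
      · have hy' : y.val = (⟨y.val - 1, by omega⟩ : Fin n).val + 1 := by simp; omega
        rw [hinv _ _ (adj_vertical hn x ⟨y.val - 1, by omega⟩ y hy'), hvert x _ y hy']; simp
      · simp [hnone]
    rw [eu, ed]
    simp only [hF, sub_add_cancel]
    ring
  -- Each horizontal edge occurs once from each end, so it contributes 2 (1 - cos θ) h h' ≤ θ² h h'.
  rw [Finset.sum_congr rfl fun x _ => hterm x, Finset.sum_add_distrib,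
    show ∑ x, F (x - 1) = ∑ x, F x from Equiv.sum_comp (Equiv.subRight (1 : ZMod n)) F,
    ← Finset.sum_add_distrib]
  refine Finset.sum_le_sum fun x _ => ?_
  have hc := Real.one_sub_sq_div_two_le_cos (x := θ x y)
  have hh : 0 ≤ h (some (x, y)) * h (some (x + 1, y)) := mul_nonneg (hnn _) (hnn _)
  simp only [hF]
  nlinarith

/-- The weighted `ℓ²` bound on a row for a function dominated by the Green's function. -/
theorem row_sum_le [NeZero n] (hn : 3 ≤ n) (x₀ : ZMod n) (y₀ y : Fin n)
    {h : Option (ZMod n × Fin n) → ℝ}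
    (hb : ∀ u, 0 ≤ h u ∧ h u ≤ 1 ∧ h u ≤ 4 * green x₀ y₀.val u) :
    ∑ x : ZMod n, (((y.val : ℝ) - y₀.val) ^ 2 + (n : ℝ) ^ 2 * freq (x - x₀) ^ 2) *
      (2 * (h (some (x, y)) * h (some (x + 1, y)))) ≤ (19050 : ℝ) * (n : ℝ) := by
  have hn0 : (0 : ℝ) < n := by exact_mod_cast (by omega : 0 < n)
  by_cases hy : y.val ≤ y₀.val
  swap
  · have hz : ∀ x, h (some (x, y)) = 0 := by
      intro x
      have := (hb (some (x, y))).2.2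
      simp only [green, if_neg hy, mul_zero] at this
      exact le_antisymm this (hb _).1
    simp only [hz, mul_zero, Finset.sum_const_zero]
    positivity
  set H : ZMod n → ℝ := fun x => h (some (x, y)) ^ 2 with hH
  set f : ZMod n → ℝ := fun x => freq (x - x₀) ^ 2 with hf
  set Y : ℝ := ((y.val : ℝ) - y₀.val) ^ 2 with hY
  set P : ZMod n → ℝ := fun x => poisson (y₀.val + 2) (x - x₀) (y.val + 1) ^ 2 with hP
  have hHP : ∀ x, H x ≤ 16 * P x := by
    intro x
    have h1 := hb (some (x, y))
    have h2 := h1.2.2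
    simp only [green, if_pos hy] at h2
    have := pow_le_pow_left₀ h1.1 h2 2
    simp only [hH, hP]
    linarith
  have hH0 : ∀ x, 0 ≤ H x := fun x => sq_nonneg _
  have hH1 : ∀ x, H x ≤ 1 := fun x => pow_le_one₀ (hb _).1 (hb _).2.1
  have hf0 : ∀ x, 0 ≤ f x := fun x => sq_nonneg _
  have hY0 : 0 ≤ Y := sq_nonneg _
  -- Transfers the weight at x to x + 1, at the cost of a factor 2 and of 2 · 7² = 98, so that the
  -- product h h' can be split into squares at its two ends.
  have hfshift : ∀ x, n ^ 2 * f x ≤ 2 * (n ^ 2 * f (x + 1)) + 98 := by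
    intro x
    have h1 := freq_add_le (x + 1 - x₀) (-1 : ZMod n)
    rw [freq_neg, show x + 1 - x₀ + -1 = x - x₀ by ring] at h1
    have h2 := freq_one_le (n := n) (by omega)
    have h3 : freq (x - x₀) ≤ freq (x + 1 - x₀) + 7 / n := by linarith
    have h4 := pow_le_pow_left₀ (freq_nonneg _) h3 2
    have h5 : (freq (x + 1 - x₀) + 7 / n) ^ 2 ≤ 2 * freq (x + 1 - x₀) ^ 2 + 2 * (7 / n) ^ 2 := by
      nlinarith [sq_nonneg (freq (x + 1 - x₀) - 7 / n)]
    calc (n : ℝ) ^ 2 * f x ≤ n ^ 2 * (2 * freq (x + 1 - x₀) ^ 2 + 2 * (7 / n) ^ 2) := by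
          gcongr; exact h4.trans h5
      _ = _ := by simp only [hf]; field_simp; ring
  have hterm : ∀ x, (Y + n ^ 2 * f x) * (2 * (h (some (x, y)) * h (some (x + 1, y)))) ≤
      (Y + n ^ 2 * f x) * H x + (Y + 2 * (n ^ 2 * f (x + 1)) + 98) * H (x + 1) := by
    intro x
    have h1 : 2 * (h (some (x, y)) * h (some (x + 1, y))) ≤ H x + H (x + 1) := by
      simp only [hH]
      nlinarith [sq_nonneg (h (some (x, y)) - h (some (x + 1, y)))]
    have h2 : 0 ≤ Y + n ^ 2 * f x := add_nonneg hY0 (mul_nonneg (by positivity) (hf0 x))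
    calc _ ≤ (Y + n ^ 2 * f x) * (H x + H (x + 1)) := mul_le_mul_of_nonneg_left h1 h2
      _ = (Y + n ^ 2 * f x) * H x + (Y + n ^ 2 * f x) * H (x + 1) := by ring
      _ ≤ _ := by
        have := mul_le_mul_of_nonneg_right
          (by linarith [hfshift x] : Y + n ^ 2 * f x ≤ Y + 2 * (n ^ 2 * f (x + 1)) + 98)
          (hH0 (x + 1))
        linarith
  -- In shifted heights the distance M - j is y₀ - y + 1, which dominates y₀ - y.
  have hsum1 : ∑ x, Y * P x ≤ 5 / 4 * n := by
    have h1 := sum_height_sq_mul_poisson_sq_le (n := n) (by omega) (M := y₀.val + 2)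
      (j := y.val + 1) (by omega) (by omega) (by have := y₀.2; omega)
    rw [← Equiv.sum_comp (Equiv.subRight x₀)] at h1
    refine le_trans (Finset.sum_le_sum fun x _ => ?_) h1
    simp only [hP, Equiv.subRight_apply]
    refine mul_le_mul_of_nonneg_right ?_ (sq_nonneg _)
    rw [hY, Nat.cast_sub (by omega)]
    push_cast
    have : (y.val : ℝ) ≤ y₀.val := by exact_mod_cast hy
    nlinarith
  have hsum2 : ∑ x, f x * P x ≤ 394 / n := by
    have h1 := sum_freq_sq_mul_poisson_sq_le_div (n := n) (by omega) (M := y₀.val + 2)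
      (j := y.val + 1) (by omega) (by omega)
    rw [← Equiv.sum_comp (Equiv.subRight x₀)] at h1
    exact h1
  have hs1 : ∑ x, Y * H x ≤ 20 * n := by
    calc _ ≤ ∑ x, 16 * (Y * P x) := Finset.sum_le_sum fun x _ => by
          nlinarith [mul_le_mul_of_nonneg_left (hHP x) hY0]
      _ ≤ _ := by rw [← Finset.mul_sum]; linarith
  have hs2 : ∑ x, n ^ 2 * f x * H x ≤ 6304 * n := by
    calc _ ≤ ∑ x, 16 * n ^ 2 * (f x * P x) := Finset.sum_le_sum fun x _ => by
          nlinarith [mul_le_mul_of_nonneg_left (hHP x)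
            (mul_nonneg (sq_nonneg (n : ℝ)) (hf0 x))]
      _ = 16 * n ^ 2 * ∑ x, f x * P x := by rw [← Finset.mul_sum]
      _ ≤ 16 * n ^ 2 * (394 / n) := by gcongr
      _ = _ := by field_simp; norm_num
  have hs3 : ∑ x, H x ≤ n := by
    calc _ ≤ ∑ _x : ZMod n, (1 : ℝ) := Finset.sum_le_sum fun x _ => hH1 x
      _ = _ := by simp [ZMod.card]
  calc _ ≤ ∑ x, ((Y + n ^ 2 * f x) * H x + (Y + 2 * (n ^ 2 * f (x + 1)) + 98) * H (x + 1)) :=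
        Finset.sum_le_sum fun x _ => hterm x
    _ = ∑ x, ((Y + n ^ 2 * f x) * H x + (Y + 2 * (n ^ 2 * f x) + 98) * H x) := by
        rw [Finset.sum_add_distrib, Finset.sum_add_distrib]
        congr 1
        exact Equiv.sum_comp (Equiv.addRight (1 : ZMod n))
          (fun x => (Y + 2 * (n ^ 2 * f x) + 98) * H x)
    _ = 2 * ∑ x, Y * H x + 3 * ∑ x, n ^ 2 * f x * H x + 98 * ∑ x, H x := by
        rw [Finset.mul_sum, Finset.mul_sum, Finset.mul_sum, ← Finset.sum_add_distrib,
          ← Finset.sum_add_distrib]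
        exact Finset.sum_congr rfl fun x _ => by ring
    -- 2 · 20 + 3 · 6304 + 98 = 19050, where 20 = 16 · 5/4 and 6304 = 16 · 394; the 16 is the square
    -- of the factor 4 in the Green's function bound.
    _ ≤ 19050 * n := by linarith

/-- The test function for the elimination step. -/
theorem exists_test_function [NeZero n] (hn : 3 ≤ n) {c : ℝ} (Φ : Connection (wiredCylinder n))
    (hface : HasFaceMonodromy Φ (c / (n : ℝ) ^ 2)) (hbot : HasTrivialBottomMonodromy Φ)
    (x₀ : ZMod n) (y₀ : Fin n) {S : Finset (Option (ZMod n × Fin n))} (hnone : none ∉ S)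
    (hrow : ∀ u ∈ S, row u ≤ y₀.val) {h : Option (ZMod n × Fin n) → ℝ}
    (h1 : h (some (x₀, y₀)) = 1) (h0 : ∀ u, u ∉ insert (some (x₀, y₀)) S → h u = 0)
    (hharm : ∀ u ∈ S, realLap (wiredCylinder n) h u = 0) :
    ∃ k : Option (ZMod n × Fin n) → ℂ, k (some (x₀, y₀)) = 1 ∧
      (∀ u, u ∉ insert (some (x₀, y₀)) S → k u = 0) ∧
      energy Φ k ≤ (1 + 19050 * c ^ 2 / n ^ 2) *
        energy (Connection.trivial (wiredCylinder n)) (fun u => (h u : ℂ)) := by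
  have hn0 : (0 : ℝ) < n := by exact_mod_cast (by omega : 0 < n)
  have hb := harmonic_bounds hn x₀ y₀ hnone hrow h1 h0 hharm
  have hE := one_le_energy hn x₀ y₀ hnone hrow h1 h0 hharm
  set e : ℝ := c / (n : ℝ) ^ 2 with he
  -- The horizontal offset -(e y₀) cos(2π(x - x₀)/n) has mean zero, as required to preserve the
  -- bottom monodromy, and cancels the phase e y₀ at the pole.
  obtain ⟨l, hvert, hhor⟩ := exists_gauge hn Φ hface hbot
    (fun x => -(e * y₀.val) * (ZMod.stdAddChar (x - x₀) : ℂ).re)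
    (by rw [← Finset.mul_sum, sum_stdAddChar_re (by omega), mul_zero])
  set v : Option (ZMod n × Fin n) := some (x₀, y₀) with hv
  -- A constant phase normalises the gauge to 1 at v without changing the transformed connection.
  set l' : Option (ZMod n × Fin n) → Circle := fun u => l u * (l v)⁻¹ with hl'
  have hconj : ∀ u w, (l' u)⁻¹ * Φ.transport u w * l' w = (l u)⁻¹ * Φ.transport u w * l w := by
    intro u w
    simp only [hl', mul_inv_rev, inv_inv]
    calc _ = (l u)⁻¹ * Φ.transport u w * l w * (l v * (l v)⁻¹) := by
          simp only [mul_comm, mul_left_comm, mul_assoc]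
      _ = _ := by rw [mul_inv_cancel, mul_one]
  set θ : ZMod n → Fin n → ℝ := fun x y =>
    e * y.val + -(e * y₀.val) * (ZMod.stdAddChar (x - x₀) : ℂ).re with hθ
  have hex := excess_energy_le hn Φ l' θ
    (fun x y y' hyy => by rw [hconj]; exact hvert x y y' hyy)
    (fun x y => by rw [hconj]; exact hhor x y) h (h0 none (by simp [hnone, hv]))
    (fun u => (hb u).1)
  -- Since 1 - cos = freq²/2 ≤ freq, because freq ≤ 2, and y₀ ≤ n, the phase is at most e times the
  -- vertical distance plus n · freq.
  have hθsq : ∀ x y, θ x y ^ 2 ≤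
      2 * e ^ 2 * (((y.val : ℝ) - y₀.val) ^ 2 + n ^ 2 * freq (x - x₀) ^ 2) := by
    intro x y
    have hre : (ZMod.stdAddChar (x - x₀) : ℂ).re = 1 - freq (x - x₀) ^ 2 / 2 := by
      rw [freq_sq]; ring
    have hf0 := freq_nonneg (x - x₀)
    have hf2 := freq_le_two (x - x₀)
    have hy0 : (y₀.val : ℝ) ≤ n := by exact_mod_cast y₀.2.le
    have hsplit : θ x y = e * (((y.val : ℝ) - y₀.val) + y₀.val * (freq (x - x₀) ^ 2 / 2)) := by
      simp only [hθ, hre]; ring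
    have hB : (y₀.val : ℝ) * (freq (x - x₀) ^ 2 / 2) ≤ n * freq (x - x₀) := by
      have : freq (x - x₀) ^ 2 / 2 ≤ freq (x - x₀) := by nlinarith
      gcongr
    have hB2 := (pow_le_pow_left₀ (by positivity) hB 2).trans_eq (mul_pow _ _ _)
    rw [hsplit, mul_pow]
    set A : ℝ := (y.val : ℝ) - y₀.val
    set B : ℝ := (y₀.val : ℝ) * (freq (x - x₀) ^ 2 / 2)
    have hAB : (A + B) ^ 2 ≤ 2 * (A ^ 2 + n ^ 2 * freq (x - x₀) ^ 2) := by
      nlinarith [sq_nonneg (A - B)]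
    calc e ^ 2 * (A + B) ^ 2 ≤ e ^ 2 * (2 * (A ^ 2 + n ^ 2 * freq (x - x₀) ^ 2)) := by gcongr
      _ = _ := by ring
  have hsum : ∑ y : Fin n, ∑ x : ZMod n, θ x y ^ 2 * (h (some (x, y)) * h (some (x + 1, y))) ≤
      19050 * c ^ 2 / n ^ 2 := by
    calc _ ≤ ∑ y : Fin n, ∑ x : ZMod n,
          e ^ 2 * ((((y.val : ℝ) - y₀.val) ^ 2 + n ^ 2 * freq (x - x₀) ^ 2) *
            (2 * (h (some (x, y)) * h (some (x + 1, y))))) := by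
          refine Finset.sum_le_sum fun y _ => Finset.sum_le_sum fun x _ => ?_
          have := mul_le_mul_of_nonneg_right (hθsq x y)
            (mul_nonneg (hb (some (x, y))).1 (hb (some (x + 1, y))).1)
          linarith
      _ ≤ ∑ _y : Fin n, e ^ 2 * (19050 * n) := by
          refine Finset.sum_le_sum fun y _ => ?_
          rw [← Finset.mul_sum]
          exact mul_le_mul_of_nonneg_left (row_sum_le hn x₀ y₀ y hb) (sq_nonneg _)
      _ = _ := by
          rw [Finset.sum_const, Finset.card_univ, Fintype.card_fin, nsmul_eq_mul, he]
          field_simp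
  refine ⟨fun u => (l' u : ℂ) * (h u : ℂ), ?_, fun u hu => by simp [h0 u hu], ?_⟩
  · simp [hl', h1]
  · rw [energy_gauge]
    -- The absolute excess becomes a relative one because the trivial energy is at least 1.
    have hε : 0 ≤ 19050 * c ^ 2 / (n : ℝ) ^ 2 := by positivity
    have := hex.trans hsum
    nlinarith

theorem lap_empty_det {W : Type*} [Fintype W] [DecidableEq W] {G : SimpleGraph W}
    (Φ : Connection G) : (lap Φ ∅).det = 1 := by
  have : lap Φ ∅ = 1 := by
    ext u w
    simp [lap, Matrix.one_apply]
  rw [this, Matrix.det_one]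

theorem det_lap_le [NeZero n] (hn : 3 ≤ n) {c : ℝ} (Φ : Connection (wiredCylinder n))
    (hface : HasFaceMonodromy Φ (c / (n : ℝ) ^ 2)) (hbot : HasTrivialBottomMonodromy Φ)
    (S : Finset (Option (ZMod n × Fin n))) (hS : none ∉ S) :
    ∃ a b : ℝ, 0 < a ∧ 0 < b ∧ (lap Φ S).det = a ∧
      (lap (Connection.trivial (wiredCylinder n)) S).det = b ∧
      a ≤ (1 + 19050 * c ^ 2 / n ^ 2) ^ S.card * b := by
  -- The vertex added last lies in a highest row of the set, so all other vertices of the domain are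
  -- at or below it; the order within a row is immaterial.
  induction S using Finset.induction_on_max_value (f := row) with
  | empty =>
    exact ⟨1, 1, one_pos, one_pos, by simp [lap_empty_det], by simp [lap_empty_det], by simp⟩
  | insert v S hv hmax ih =>
    rw [Finset.mem_insert, not_or] at hS
    obtain ⟨a, b, ha, hb, hda, hdb, hab⟩ := ih hS.2
    obtain _ | ⟨x₀, y₀⟩ := v
    · exact absurd rfl hS.1
    rw [Finset.card_insert_of_notMem hv, pow_succ']
    exact det_lap_insert_le (preconnected hn) Φ hv (Ne.symm hS.1) hS.2 ha hb hda hdb hab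
      fun h h1 h0 hharm => exists_test_function hn Φ hface hbot x₀ y₀ hS.2 hmax h1 h0 hharm

end Cylinder

/-! ### Conclusion -/

theorem mainTheorem11 :
    ∀ C : ℝ, 0 < C → ∃ K : ℝ, 0 < K ∧
      ∀ (n : ℕ) [NeZero n], 3 ≤ n → ∀ c : ℝ, |c| ≤ C →
        ∀ Φ : CRSF.Connection (wiredCylinder n),
          HasFaceMonodromy Φ (c / (n : ℝ) ^ 2) → HasTrivialBottomMonodromy Φ →
            0 < CRSF.partitionFunction none (CRSF.Connection.trivial (wiredCylinder n)) ∧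
            0 < CRSF.partitionFunction none Φ ∧
            |CRSF.partitionFunction none Φ /
                CRSF.partitionFunction none (CRSF.Connection.trivial (wiredCylinder n)) - 1|
              ≤ K * c ^ 2 ∧
            1 - K * c ^ 2 ≤ CRSF.prob none Φ {Γ | CRSF.cycles Γ = ∅} := by
  intro C hC
  refine ⟨19050 * Real.exp (19050 * C ^ 2), by positivity, ?_⟩
  intro n _ hn c hc Φ hface hbot
  have hn0 : (0 : ℝ) < n := by exact_mod_cast (by omega : 0 < n)
  obtain ⟨a, b, ha, hb, hda, hdb, hab⟩ :=
    Cylinder.det_lap_le hn Φ hface hbot (Finset.univ.erase none) (by simp)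
  rw [← CRSF.partitionFunction_eq_det] at hda hdb
  have hZ := Complex.ofReal_injective hda
  have hI := Complex.ofReal_injective hdb
  have hpos : 0 < CRSF.partitionFunction none (CRSF.Connection.trivial (wiredCylinder n)) := by
    rw [hI]; exact hb
  refine ⟨hpos, CRSF.ratio_and_prob_of_le none Φ hpos ?_⟩
  rw [hZ, hI]
  refine hab.trans (mul_le_mul_of_nonneg_right ?_ hb.le)
  have hcard : (Finset.univ.erase (none : Option (ZMod n × Fin n))).card = n ^ 2 := by
    rw [Finset.card_erase_of_mem (Finset.mem_univ _), Finset.card_univ, Fintype.card_option,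
      Fintype.card_prod, ZMod.card, Fintype.card_fin]
    simp [pow_two]
  have hc2 : c ^ 2 ≤ C ^ 2 := by rw [← sq_abs c]; exact pow_le_pow_left₀ (abs_nonneg c) hc 2
  set X : ℝ := 19050 * c ^ 2 with hX
  have hX0 : 0 ≤ X := by positivity
  calc (1 + X / (n : ℝ) ^ 2) ^ (Finset.univ.erase (none : Option (ZMod n × Fin n))).card
      ≤ Real.exp (X / (n : ℝ) ^ 2) ^ (n ^ 2) := by
        rw [hcard]
        refine pow_le_pow_left₀ (by positivity) ?_ _
        rw [add_comm]
        exact Real.add_one_le_exp _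
    _ = Real.exp X := by
        rw [← Real.exp_nat_mul]
        congr 1
        push_cast
        field_simp
    -- This is 1 - X ≤ exp(-X) multiplied by exp X; boundedness of c then makes exp X a constant.
    _ ≤ 1 + X * Real.exp X := by
        have h1 := Real.add_one_le_exp (-X)
        have h2 := mul_le_mul_of_nonneg_right h1 (Real.exp_pos X).le
        rw [← Real.exp_add, neg_add_cancel, Real.exp_zero] at h2
        linarith
    _ ≤ 1 + X * Real.exp (19050 * C ^ 2) := by
        have : Real.exp X ≤ Real.exp (19050 * C ^ 2) := Real.exp_le_exp.mpr (by rw [hX]; gcongr)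
        gcongr
    _ = _ := by rw [hX]; ring
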